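/- Let $d\ge 1$, let $\Omega\subset\mathbb R^d$ be a nonempty bounded convex open set that is strictly convex (the open segment between any two distinct points of $\overline\Omega$ lies in the interior of $\overline\Omega$), let $f\in C(\overline\Omega)$, and let $$u(x)=\sup\{l(x): l \text{ affine},\ l\le f \text{ in }\overline\Omega\}$$ be the convex envelope of $f$. A mesh $\mathcal T_h$ is a nonempty finite conforming simplicial mesh of closed $d$-simplices $T$; $h_T$ is the diameter of $T$, $\rho_T$ the diameter of the largest ball inscribed in $T$, $h=\max_T h_T$, $\Omega_h$ is the interior of the union of the $T\in\mathcal T_h$, and $\mathcal N_h$ is the set of nodes. It is required that the nodes lying on $\partial\Omega_h$ lie on $\partial\Omega$. Put $\mathcal N_h^b=\mathcal N_h\cap\partial\Omega$ and $\mathcal N_h^0=\mathcal N_h\setminus\mathcal N_h^b$. Let $\mathbb V_h$ be the space of continuous functions on $\overline\Omega_h$ that are affine on each $T$. Let $\mathbb S_\theta$ be a finite set of unit vectors such that every unit vector is within distance $\theta$ of some element of $\mathbb S_\theta$. For $\delta>0$ and $x_i\in\mathcal N_h^0$ put $\delta_i=\min\{\delta,\operatorname{dist}(x_i,\partial\Omega_h)\}$,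 and for $\varepsilon=(h,\delta,\theta)$ and $w\in\mathbb V_h$ put $$\nabla^2_\delta w(x_i;v)=\frac{w(x_i+\delta_i v)-2w(x_i)+w(x_i-\delta_i v)}{\delta_i^2},\qquad T_\varepsilon[w;f](x_i)=\min\Big\{f(x_i)-w(x_i),\ \min_{v\in\mathbb S_\theta}\nabla^2_\delta w(x_i;v)\Big\}.$$ A discrete solution is a function $u_\varepsilon\in\mathbb V_h$ with $T_\varepsilon[u_\varepsilon;f](x_i)=0$ for all $x_i\in\mathcal N_h^0$ and $u_\varepsilon(x_i)=f(x_i)$ for all $x_i\in\mathcal N_h^b$. Then for every such mesh, every $\delta>0$ and every $\mathbb S_\theta$ there is exactly one discrete solution $u_\varepsilon$. Moreover, within any family of such meshes that is shape-regular and quasi-uniform (that is, $h_T/\rho_T\le\sigma$ and $h\le\kappa h_T$ for all $T\in\mathcal T_h$, with fixed constants $\sigma,\kappa$), $u_\varepsilon$ converges uniformly to $u$ as $(h,\delta,\theta)\to0$ and $h/\delta\to0$: for all $\sigma,\kappa$ and every $\eta>0$ there is $r>0$ such that $|u_\varepsilon(x)-u(x)|<\eta$ for all $x\in\overline\Omega_h$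 whenever $h$, $\delta$, $\theta$ and $h/\delta$ are all less than $r$. -/

import Mathlib

/-- Bounded strictly convex domains of `ℝᵈ`: nonempty bounded open convex sets whose boundary
contains no segment. Strict convexity is imposed on the closure, since `StrictConvex` holds for every
open convex set and would say nothing about `Ω` itself. -/
structure IsStrictlyConvexDomain {d : ℕ} (Ω : Set (EuclideanSpace ℝ (Fin d))) : Prop where
  isOpen : IsOpen Ω
  nonempty : Ω.Nonempty
  isBounded : Bornology.IsBounded Ω
  convex : Convex ℝ Ω
  strictConvex_closure : StrictConvex ℝ (closure Ω)

/-- The convex envelope of `f` in `Ω`: the pointwise supremum of the affine functions that are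
`≤ f` in the closure of `Ω`. -/
noncomputable def convexEnvelope {d : ℕ} (Ω : Set (EuclideanSpace ℝ (Fin d)))
    (f : EuclideanSpace ℝ (Fin d) → ℝ) (x : EuclideanSpace ℝ (Fin d)) : ℝ :=
  sSup {t : ℝ | ∃ l : EuclideanSpace ℝ (Fin d) →ᵃ[ℝ] ℝ, (∀ y ∈ closure Ω, l y ≤ f y) ∧ t = l x}

/-- The elements of a simplicial complex in `ℝᵈ`: its `d`-dimensional simplices, each given by its
set of `d + 1` vertices. The closed simplex itself is the convex hull of this set. -/
def meshElements {d : ℕ} (K : Geometry.SimplicialComplex ℝ (EuclideanSpace ℝ (Fin d))) :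
    Set (Finset (EuclideanSpace ℝ (Fin d))) :=
  {s | s ∈ K.faces ∧ s.card = d + 1}

/-- `Ω_h`, the interior of the union of the elements. -/
def meshDomain {d : ℕ} (K : Geometry.SimplicialComplex ℝ (EuclideanSpace ℝ (Fin d))) :
    Set (EuclideanSpace ℝ (Fin d)) :=
  interior (⋃ s ∈ meshElements K, convexHull ℝ (s : Set (EuclideanSpace ℝ (Fin d))))

/-- Boundary nodes: the nodes of the mesh that lie on the boundary of `Ω`. -/
def boundaryNodes {d : ℕ} (Ω : Set (EuclideanSpace ℝ (Fin d)))
    (K : Geometry.SimplicialComplex ℝ (EuclideanSpace ℝ (Fin d))) :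
    Set (EuclideanSpace ℝ (Fin d)) :=
  {x | x ∈ K.vertices ∧ x ∈ frontier Ω}

/-- Interior nodes: all the other nodes of the mesh. -/
def interiorNodes {d : ℕ} (Ω : Set (EuclideanSpace ℝ (Fin d)))
    (K : Geometry.SimplicialComplex ℝ (EuclideanSpace ℝ (Fin d))) :
    Set (EuclideanSpace ℝ (Fin d)) :=
  K.vertices \ boundaryNodes Ω K

/-- `K` is a (conforming, finite) mesh inscribed in `Ω`: a nonempty finite simplicial complex in
which every simplex is a face of an element, and whose nodes on the boundary of `Ω_h` lie on the
boundary of `Ω`. -/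
structure IsInscribedMesh {d : ℕ} (Ω : Set (EuclideanSpace ℝ (Fin d)))
    (K : Geometry.SimplicialComplex ℝ (EuclideanSpace ℝ (Fin d))) : Prop where
  finite : K.faces.Finite
  nonempty : K.faces.Nonempty
  pure : ∀ s ∈ K.faces, ∃ t ∈ meshElements K, s ⊆ t
  nodes_frontier : ∀ x ∈ K.vertices, x ∈ frontier (meshDomain K) → x ∈ frontier Ω

/-- `h_T`, the diameter of the closed simplex with vertex set `s`. -/
noncomputable def elementDiam {d : ℕ} (s : Finset (EuclideanSpace ℝ (Fin d))) : ℝ :=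
  Metric.diam (convexHull ℝ (s : Set (EuclideanSpace ℝ (Fin d))))

/-- `ρ_T`, the diameter of the largest ball inscribed in the closed simplex with vertex set `s`. -/
noncomputable def elementInballDiam {d : ℕ} (s : Finset (EuclideanSpace ℝ (Fin d))) : ℝ :=
  sSup {ρ : ℝ | 0 ≤ ρ ∧ ∃ c : EuclideanSpace ℝ (Fin d),
    Metric.ball c (ρ / 2) ⊆ convexHull ℝ (s : Set (EuclideanSpace ℝ (Fin d)))}

/-- The mesh size `h`, the largest diameter of an element. -/
noncomputable def meshSize {d : ℕ}
    (K : Geometry.SimplicialComplex ℝ (EuclideanSpace ℝ (Fin d))) : ℝ :=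
  sSup (elementDiam '' meshElements K)

/-- Shape regularity with constant `σ`: `h_T / ρ_T ≤ σ` for all elements `T`. -/
def IsShapeRegular {d : ℕ} (σ : ℝ)
    (K : Geometry.SimplicialComplex ℝ (EuclideanSpace ℝ (Fin d))) : Prop :=
  ∀ s ∈ meshElements K, elementDiam s / elementInballDiam s ≤ σ

/-- Quasi-uniformity with constant `κ`: `h ≤ κ h_T` for all elements `T`. -/
def IsQuasiUniform {d : ℕ} (κ : ℝ)
    (K : Geometry.SimplicialComplex ℝ (EuclideanSpace ℝ (Fin d))) : Prop :=
  ∀ s ∈ meshElements K, meshSize K ≤ κ * elementDiam s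

/-- `w ∈ 𝕍_h`: `w` is continuous on the closure of `Ω_h` and affine on every element. -/
def IsPiecewiseLinear {d : ℕ} (K : Geometry.SimplicialComplex ℝ (EuclideanSpace ℝ (Fin d)))
    (w : EuclideanSpace ℝ (Fin d) → ℝ) : Prop :=
  ContinuousOn w (closure (meshDomain K)) ∧
    ∀ s ∈ meshElements K, ∃ l : EuclideanSpace ℝ (Fin d) →ᵃ[ℝ] ℝ,
      Set.EqOn w l (convexHull ℝ (s : Set (EuclideanSpace ℝ (Fin d))))

/-- `S` is a finite discretization, with parameter `θ`, of the unit sphere. -/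
def IsDirectionSet {d : ℕ} (θ : ℝ) (S : Finset (EuclideanSpace ℝ (Fin d))) : Prop :=
  (∀ v ∈ S, ‖v‖ = 1) ∧
    ∀ v : EuclideanSpace ℝ (Fin d), ‖v‖ = 1 → ∃ v' ∈ S, ‖v - v'‖ ≤ θ

/-- The local coarse scale `δ_i = min {δ, dist(x_i, ∂Ω_h)}` at the node `x_i = x`. -/
noncomputable def localScale {d : ℕ}
    (K : Geometry.SimplicialComplex ℝ (EuclideanSpace ℝ (Fin d)))
    (δ : ℝ) (x : EuclideanSpace ℝ (Fin d)) : ℝ :=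
  min δ (Metric.infDist x (frontier (meshDomain K)))

/-- The centered second difference of `w` at the node `x`, in the direction `v`. -/
noncomputable def secondDifference {d : ℕ}
    (K : Geometry.SimplicialComplex ℝ (EuclideanSpace ℝ (Fin d)))
    (δ : ℝ) (w : EuclideanSpace ℝ (Fin d) → ℝ) (x v : EuclideanSpace ℝ (Fin d)) : ℝ :=
  (w (x + localScale K δ x • v) - 2 * w x + w (x - localScale K δ x • v)) / localScale K δ x ^ 2

/-- The two-scale operator `T_ε[w; f]` at the node `x`. The infimum is over a finite set of
directions, hence a minimum. -/
noncomputable def twoScaleOperator {d : ℕ}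
    (K : Geometry.SimplicialComplex ℝ (EuclideanSpace ℝ (Fin d)))
    (δ : ℝ) (S : Finset (EuclideanSpace ℝ (Fin d)))
    (f w : EuclideanSpace ℝ (Fin d) → ℝ) (x : EuclideanSpace ℝ (Fin d)) : ℝ :=
  min (f x - w x) (⨅ v : S, secondDifference K δ w x (v : EuclideanSpace ℝ (Fin d)))

/-- `w` is a discrete solution of the two-scale method: `w ∈ 𝕍_h`, `T_ε[w; f] = 0` at the interior
nodes, and `w = f` at the boundary nodes. Only the values on the closure of `Ω_h` matter. -/
structure IsTwoScaleSolution {d : ℕ} (Ω : Set (EuclideanSpace ℝ (Fin d)))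
    (f : EuclideanSpace ℝ (Fin d) → ℝ)
    (K : Geometry.SimplicialComplex ℝ (EuclideanSpace ℝ (Fin d)))
    (δ : ℝ) (S : Finset (EuclideanSpace ℝ (Fin d)))
    (w : EuclideanSpace ℝ (Fin d) → ℝ) : Prop where
  piecewiseLinear : IsPiecewiseLinear K w
  operator_eq : ∀ x ∈ interiorNodes Ω K, twoScaleOperator K δ S f w x = 0
  boundary_eq : ∀ x ∈ boundaryNodes Ω K, w x = f x

/-! ### Geometry of inscribed meshes -/

section Mesh

variable {d : ℕ} {Ω : Set (EuclideanSpace ℝ (Fin d))}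
  {K : Geometry.SimplicialComplex ℝ (EuclideanSpace ℝ (Fin d))}

/-! The discrete equation says that the solution lies below `f` at the nodes, has nonnegative second
differences, and at each interior node is tight in one of these constraints. It is therefore the
largest discrete subsolution. Comparison (`IsTwoScaleSubsolution.le_solution`) gives uniqueness, and
Perron's method gives existence.

The lower bound is exact: every affine minorant of `f` is a discrete subsolution, so comparison and
a supremum give `u ≤ u_ε` on the mesh.

The upper bound rests on a barrier. Near `∂Ω`, strict convexity forces the envelope to equal `f` on
the boundary, so the obstacle alone suffices. Away from it, take an affine `l` supporting the
envelope at `x₀`. Then `x₀` lies in the hull `P` of at most `d + 1` points where `l = f`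
(`mem_convexHull_contact` and Carathéodory). Compare `u_ε` with `l + A + κ dist(·, P)² - c |· -
x₀|²`. Far from `P` the term in `κ` dominates the obstacle; near the vertices of `P` or near the
boundary, `f` is already close to `l`. At any other node the projection onto `P` is the midpoint of
a segment of length `2δ` in `P`. Along its direction the distance term contributes only errors of
order `κ(θ² + h²/δ²)` to the second difference, too small to offset the contribution `-c` (both up
to a factor 2). This contradicts `le_average` (`IsTwoScaleSubsolution.le_affine_add`). All constants
are uniform in `x₀`, because a support at distance `ρ` from `∂Ω` has slope at most `2M/ρ`. -/

theorem IsInscribedMesh.space_eq (hK : IsInscribedMesh Ω K) :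
    K.space = ⋃ s ∈ meshElements K, convexHull ℝ (s : Set (EuclideanSpace ℝ (Fin d))) := by
  apply subset_antisymm
  · intro x hx
    obtain ⟨s, hs, hxs⟩ := Geometry.SimplicialComplex.mem_space_iff.1 hx
    obtain ⟨t, ht, hst⟩ := hK.pure s hs
    exact Set.mem_biUnion ht (convexHull_mono (Finset.coe_subset.2 hst) hxs)
  · exact Set.iUnion₂_subset fun s hs => Geometry.SimplicialComplex.convexHull_subset_space hs.1

theorem IsInscribedMesh.exists_element (hK : IsInscribedMesh Ω K)
    {x : EuclideanSpace ℝ (Fin d)} (hx : x ∈ K.space) :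
    ∃ s ∈ meshElements K, x ∈ convexHull ℝ (s : Set (EuclideanSpace ℝ (Fin d))) := by
  rw [hK.space_eq] at hx
  simpa using hx

theorem IsInscribedMesh.isCompact_space (hK : IsInscribedMesh Ω K) : IsCompact K.space :=
  hK.finite.isCompact_biUnion fun s _ => s.finite_toSet.isCompact_convexHull ℝ

theorem interior_space_eq (hK : IsInscribedMesh Ω K) : interior K.space = meshDomain K := by
  rw [meshDomain, hK.space_eq]

theorem interior_element_nonempty {s : Finset (EuclideanSpace ℝ (Fin d))}
    (hs : s ∈ meshElements K) :
    (interior (convexHull ℝ (s : Set (EuclideanSpace ℝ (Fin d))))).Nonempty := by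
  rw [interior_convexHull_nonempty_iff_affineSpan_eq_top]
  have h := K.indep hs.1
  have h2 := h.affineSpan_eq_top_iff_card_eq_finrank_add_one.2 (by simp [hs.2])
  simpa using h2

theorem IsInscribedMesh.closure_meshDomain (hK : IsInscribedMesh Ω K) :
    closure (meshDomain K) = K.space := by
  apply subset_antisymm
  · rw [← interior_space_eq hK]
    exact closure_minimal interior_subset hK.isCompact_space.isClosed
  · intro x hx
    obtain ⟨s, hs, hxs⟩ := hK.exists_element hx
    have hcl : closure (interior (convexHull ℝ (s : Set (EuclideanSpace ℝ (Fin d)))))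
        = closure (convexHull ℝ (s : Set (EuclideanSpace ℝ (Fin d)))) :=
      (convex_convexHull ℝ _).closure_interior_eq_closure_of_nonempty_interior
        (interior_element_nonempty hs)
    rw [← interior_space_eq hK]
    exact closure_mono (interior_mono
      (Geometry.SimplicialComplex.convexHull_subset_space hs.1)) (hcl ▸ subset_closure hxs)

theorem IsInscribedMesh.frontier_meshDomain_subset (hK : IsInscribedMesh Ω K) :
    frontier (meshDomain K) ⊆ K.space :=
  hK.closure_meshDomain ▸ frontier_subset_closure

theorem IsInscribedMesh.mem_frontier_meshDomain (hK : IsInscribedMesh Ω K)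
    {x : EuclideanSpace ℝ (Fin d)} (hx : x ∈ K.space) (hx' : x ∉ interior K.space) :
    x ∈ frontier (meshDomain K) := by
  refine ⟨hK.closure_meshDomain.symm ▸ hx, ?_⟩
  rw [interior_space_eq hK] at hx'
  exact fun h => hx' (interior_subset h)

theorem IsInscribedMesh.vertices_finite (hK : IsInscribedMesh Ω K) : K.vertices.Finite := by
  rw [Geometry.SimplicialComplex.vertices_eq]
  exact hK.finite.biUnion fun s _ => s.finite_toSet

theorem mem_vertices_of_mem_face {s : Finset (EuclideanSpace ℝ (Fin d))} (hs : s ∈ K.faces)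
    {v : EuclideanSpace ℝ (Fin d)} (hv : v ∈ s) : v ∈ K.vertices := by
  rw [Geometry.SimplicialComplex.vertices_eq]
  exact Set.mem_biUnion hs hv

theorem IsInscribedMesh.space_nonempty (hK : IsInscribedMesh Ω K) : K.space.Nonempty := by
  obtain ⟨s, hs⟩ := hK.nonempty
  obtain ⟨v, hv⟩ := Geometry.SimplicialComplex.nonempty_of_mem_faces hs
  exact ⟨v, Geometry.SimplicialComplex.vertices_subset_space (mem_vertices_of_mem_face hs hv)⟩

theorem IsInscribedMesh.vertices_nonempty (hK : IsInscribedMesh Ω K) : K.vertices.Nonempty := by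
  obtain ⟨s, hs⟩ := hK.nonempty
  obtain ⟨v, hv⟩ := Geometry.SimplicialComplex.nonempty_of_mem_faces hs
  exact ⟨v, mem_vertices_of_mem_face hs hv⟩

/-- An element of the mesh has diameter at most the mesh size. -/
theorem IsInscribedMesh.dist_le_meshSize (hK : IsInscribedMesh Ω K)
    {s : Finset (EuclideanSpace ℝ (Fin d))} (hs : s ∈ meshElements K)
    {x y : EuclideanSpace ℝ (Fin d)}
    (hx : x ∈ convexHull ℝ (s : Set (EuclideanSpace ℝ (Fin d))))
    (hy : y ∈ convexHull ℝ (s : Set (EuclideanSpace ℝ (Fin d)))) :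
    dist x y ≤ meshSize K := by
  have h1 : dist x y ≤ elementDiam s :=
    Metric.dist_le_diam_of_mem (s.finite_toSet.isCompact_convexHull ℝ).isBounded hx hy
  have hfin : (meshElements K).Finite := hK.finite.subset fun s hs => hs.1
  exact h1.trans (le_csSup (hfin.image _).bddAbove (Set.mem_image_of_mem _ hs))

/-- A linear functional which is maximal over a set at an interior point vanishes. -/
theorem eq_zero_of_isMaxOn_interior {E : Type*} [NormedAddCommGroup E] [NormedSpace ℝ E]
    (m : E →L[ℝ] ℝ) {A : Set E} {x : E} (hx : x ∈ interior A) (h : ∀ y ∈ A, m y ≤ m x) :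
    m = 0 := by
  have hloc : IsLocalMax m x := by
    filter_upwards [mem_interior_iff_mem_nhds.1 hx] with y hy using h y hy
  have := hloc.fderiv_eq_zero
  rwa [m.fderiv] at this

/-- An inscribed mesh does not leave the closure of the domain. -/
theorem IsInscribedMesh.space_subset_closure (hΩ : IsStrictlyConvexDomain Ω)
    (hK : IsInscribedMesh Ω K) : K.space ⊆ closure Ω := by
  intro x hx
  by_contra hxΩ
  obtain ⟨m, c, hm1, hm2⟩ :=
    geometric_hahn_banach_closed_point hΩ.convex.closure isClosed_closure hxΩ
  -- A vertex maximizing `m` maximizes it over the whole mesh. As `m` is nonzero, that vertex is on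
  -- the mesh boundary, hence on `∂Ω`, which contradicts the separation.
  obtain ⟨z, hz, hzmax⟩ := hK.vertices_finite.exists_maximalFor m _ hK.vertices_nonempty
  have hzv : ∀ v ∈ K.vertices, m v ≤ m z := by
    intro v hv
    rcases le_total (m v) (m z) with h | h
    · exact h
    · exact hzmax hv h
  have hzs : ∀ y ∈ K.space, m y ≤ m z := by
    intro y hy
    obtain ⟨s, hs, hys⟩ := Geometry.SimplicialComplex.mem_space_iff.1 hy
    have hsub : convexHull ℝ (s : Set (EuclideanSpace ℝ (Fin d))) ⊆ {y | m y ≤ m z} :=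
      convexHull_min (fun v hv => hzv v (mem_vertices_of_mem_face hs hv))
        (convex_halfSpace_le m.toLinearMap.isLinear _)
    exact hsub hys
  have hzi : z ∉ interior K.space := by
    intro hzi
    have := eq_zero_of_isMaxOn_interior m hzi hzs
    subst this
    obtain ⟨y, hy⟩ := hΩ.nonempty
    have h1 := hm1 y (subset_closure hy)
    simp only [zero_apply] at h1 hm2
    linarith
  have hzf : z ∈ frontier Ω := hK.nodes_frontier z hz
    (hK.mem_frontier_meshDomain (Geometry.SimplicialComplex.vertices_subset_space hz) hzi)
  linarith [hm1 z (frontier_subset_closure hzf), hzs x hx]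

/-! ### Interior nodes and the local scale -/

theorem IsInscribedMesh.interiorNodes_subset (hK : IsInscribedMesh Ω K) :
    interiorNodes Ω K ⊆ meshDomain K := by
  intro x hx
  by_contra h
  rw [← interior_space_eq hK] at h
  exact hx.2 ⟨hx.1, hK.nodes_frontier x hx.1
    (hK.mem_frontier_meshDomain (Geometry.SimplicialComplex.vertices_subset_space hx.1) h)⟩

theorem IsInscribedMesh.meshDomain_ne_univ (hd : 1 ≤ d) (hK : IsInscribedMesh Ω K) :
    meshDomain K ≠ Set.univ := by
  intro h
  have : Nonempty (Fin d) := ⟨⟨0, hd⟩⟩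
  have h1 : K.space = Set.univ := by
    rw [← hK.closure_meshDomain, h, closure_univ]
  exact noncompact_univ (EuclideanSpace ℝ (Fin d)) (h1 ▸ hK.isCompact_space)

/-- Since `Metric.infDist` to the empty set is 0, the frontier must be shown nonempty; it is,
because for `d ≥ 1` a compact mesh cannot fill the space. -/
theorem IsInscribedMesh.localScale_pos (hd : 1 ≤ d) (hK : IsInscribedMesh Ω K) {δ : ℝ}
    (hδ : 0 < δ) {x : EuclideanSpace ℝ (Fin d)} (hx : x ∈ interiorNodes Ω K) :
    0 < localScale K δ x := by
  have hxm := hK.interiorNodes_subset hx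
  have hopen : IsOpen (meshDomain K) := isOpen_interior
  obtain ⟨y, hy, -⟩ := exists_mem_frontier_infDist_compl_eq_dist hxm (hK.meshDomain_ne_univ hd)
  refine lt_min hδ ((isClosed_frontier.notMem_iff_infDist_pos ⟨y, hy⟩).1 ?_)
  rw [hopen.frontier_eq]
  exact fun h => h.2 hxm

/-- The ball of radius `localScale K δ x` about an interior node stays in the mesh. -/
theorem IsInscribedMesh.closedBall_localScale_subset (hd : 1 ≤ d) (hK : IsInscribedMesh Ω K)
    (δ : ℝ) {x : EuclideanSpace ℝ (Fin d)} (hx : x ∈ interiorNodes Ω K) :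
    Metric.closedBall x (localScale K δ x) ⊆ K.space := by
  have hxm := hK.interiorNodes_subset hx
  obtain ⟨y, hy, hxy⟩ := exists_mem_frontier_infDist_compl_eq_dist hxm (hK.meshDomain_ne_univ hd)
  rw [← hK.closure_meshDomain]
  refine (Metric.closedBall_subset_closedBall ?_).trans
    (Metric.closedBall_infDist_compl_subset_closure hxm)
  rw [hxy]
  exact (min_le_right _ _).trans (Metric.infDist_le_dist_of_mem hy)

theorem IsInscribedMesh.add_smul_mem_space (hd : 1 ≤ d) (hK : IsInscribedMesh Ω K)
    {δ : ℝ} (hδ : 0 < δ) {x v : EuclideanSpace ℝ (Fin d)} (hx : x ∈ interiorNodes Ω K)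
    (hv : ‖v‖ = 1) :
    x + localScale K δ x • v ∈ K.space ∧ x - localScale K δ x • v ∈ K.space := by
  have h := hK.localScale_pos hd hδ hx
  constructor <;> apply hK.closedBall_localScale_subset hd δ hx <;>
    simp [norm_smul, hv, abs_of_pos h, dist_eq_norm]

/-- A face of an affinely independent simplex is an extreme set. -/
theorem mem_convexHull_of_openSegment {E : Type*} [AddCommGroup E] [Module ℝ E]
    {s t : Finset E} (hs : AffineIndependent ℝ ((↑) : s → E)) (hts : t ⊆ s) {x y z : E}
    (hx : x ∈ convexHull ℝ (s : Set E)) (hy : y ∈ convexHull ℝ (s : Set E))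
    (hz : z ∈ convexHull ℝ (t : Set E)) (hzxy : z ∈ openSegment ℝ x y) :
    x ∈ convexHull ℝ (t : Set E) := by
  classical
  rw [Finset.mem_convexHull'] at hx hy hz
  obtain ⟨wx, hwx0, hwx1, hwx⟩ := hx
  obtain ⟨wy, hwy0, hwy1, hwy⟩ := hy
  obtain ⟨wz, hwz0, hwz1, hwz⟩ := hz
  obtain ⟨a, b, ha, hb, hab, h⟩ := hzxy
  -- Extend the weights of `z` by zero to `s`. By affine independence they equal `a wx + b wy`; off
  -- `t` this sum of nonnegative terms vanishes, so `wx` vanishes there.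
  set wz' : E → ℝ := fun v => if v ∈ t then wz v else 0 with hwz'
  have e1 : ∑ v ∈ s, wz' v = 1 := by
    rw [← hwz1, ← Finset.sum_filter, Finset.filter_mem_eq_inter, Finset.inter_eq_right.2 hts]
  have e2 : ∑ v ∈ s, wz' v • v = z := by
    simp only [hwz', ite_smul, zero_smul]
    rw [← hwz, ← Finset.sum_filter, Finset.filter_mem_eq_inter, Finset.inter_eq_right.2 hts]
  have key := (affineIndependent_iff.1 hs) Finset.univ
    (fun v => wz' v - (a * wx v + b * wy v))
    (by
      rw [Finset.univ_eq_attach, Finset.sum_attach s (fun v => wz' v - (a * wx v + b * wy v)),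
        Finset.sum_sub_distrib, e1, Finset.sum_add_distrib, ← Finset.mul_sum, ← Finset.mul_sum,
        hwx1, hwy1]
      linarith)
    (by
      rw [Finset.univ_eq_attach,
        Finset.sum_attach s (fun v => (wz' v - (a * wx v + b * wy v)) • v)]
      simp only [sub_smul, add_smul, mul_smul]
      rw [Finset.sum_sub_distrib, e2, Finset.sum_add_distrib, ← Finset.smul_sum, ← Finset.smul_sum,
        hwx, hwy, h, sub_self])
  have hzero : ∀ v ∈ s, v ∉ t → wx v = 0 := by
    intro v hv hvt
    have := key ⟨v, hv⟩ (Finset.mem_univ _)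
    simp only [hwz', if_neg hvt] at this
    have h1 := mul_nonneg ha.le (hwx0 v hv)
    have h2 := mul_nonneg hb.le (hwy0 v hv)
    have h3 : a * wx v = 0 := by linarith
    exact (mul_eq_zero.1 h3).resolve_left ha.ne'
  rw [Finset.mem_convexHull']
  refine ⟨wx, fun v hv => hwx0 v (hts hv), ?_, ?_⟩
  · rw [← hwx1]
    exact Finset.sum_subset hts fun v hv hvt => hzero v hv hvt
  · rw [← hwx]
    exact Finset.sum_subset hts fun v hv hvt => by rw [hzero v hv hvt, zero_smul]

/-- From a point outside the mesh, the boundary of the domain is not much further than the mesh. -/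
theorem IsInscribedMesh.exists_frontier_dist_le_of_notMem (hK : IsInscribedMesh Ω K)
    {q : EuclideanSpace ℝ (Fin d)} (hq : q ∉ K.space) :
    ∃ v ∈ frontier Ω, ∀ z ∈ K.space, dist q v ≤ dist q z + meshSize K := by
  classical
  obtain ⟨z, hz, hqz⟩ := hK.isCompact_space.exists_infDist_eq_dist hK.space_nonempty q
  have hzmin : ∀ y ∈ K.space, dist q z ≤ dist q y := fun y hy =>
    hqz ▸ Metric.infDist_le_dist_of_mem hy
  have hne : {s : Finset (EuclideanSpace ℝ (Fin d)) |
      s ∈ K.faces ∧ z ∈ convexHull ℝ (s : Set (EuclideanSpace ℝ (Fin d)))}.Nonempty := by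
    obtain ⟨s, hs, hzs⟩ := Geometry.SimplicialComplex.mem_space_iff.1 hz
    exact ⟨s, hs, hzs⟩
  -- For `z` nearest to `q`, a face of least cardinality has `z` in its relative interior. Any
  -- vertex `v` of it turns out to be a boundary node, and it shares an element with `z`.
  obtain ⟨s, ⟨hs, hzs⟩, hmin⟩ := exists_minimalFor_of_wellFoundedLT _ Finset.card hne
  obtain ⟨v, hv⟩ := Geometry.SimplicialComplex.nonempty_of_mem_faces hs
  have hvs : v ∈ convexHull ℝ (s : Set (EuclideanSpace ℝ (Fin d))) := subset_convexHull ℝ _ hv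
  have hvK := mem_vertices_of_mem_face hs hv
  have hvsp := Geometry.SimplicialComplex.vertices_subset_space hvK
  -- faces meeting the open segment from `z` to `v` contain `z`
  have hface : ∀ t ∈ K.faces, ∀ y ∈ openSegment ℝ z v,
      y ∈ convexHull ℝ (t : Set (EuclideanSpace ℝ (Fin d))) →
      z ∈ convexHull ℝ (t : Set (EuclideanSpace ℝ (Fin d))) := by
    intro t ht y hy hyt
    have hys : y ∈ convexHull ℝ (s : Set (EuclideanSpace ℝ (Fin d))) :=
      (convex_convexHull ℝ _).openSegment_subset hzs hvs hy
    have hyst := K.inter_subset_convexHull hs ht ⟨hys, hyt⟩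
    rw [← Finset.coe_inter] at hyst
    have hzst := mem_convexHull_of_openSegment (K.indep hs) Finset.inter_subset_left hzs hvs
      hyst hy
    exact convexHull_mono (Finset.coe_subset.2 Finset.inter_subset_right) hzst
  -- elements containing `z` lie in a half-space
  have hhalf : ∀ t ∈ K.faces, z ∈ convexHull ℝ (t : Set (EuclideanSpace ℝ (Fin d))) →
      ∀ y ∈ convexHull ℝ (t : Set (EuclideanSpace ℝ (Fin d))),
        inner ℝ (q - z) (y - z) ≤ 0 := by
    intro t ht hzt
    refine (norm_eq_iInf_iff_real_inner_le_zero (convex_convexHull ℝ _) hzt).1 ?_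
    apply le_antisymm
    · have : Nonempty (convexHull ℝ (t : Set (EuclideanSpace ℝ (Fin d)))) := ⟨⟨z, hzt⟩⟩
      refine le_ciInf fun y => ?_
      simpa [dist_eq_norm] using hzmin y (Geometry.SimplicialComplex.convexHull_subset_space ht y.2)
    · exact ciInf_le ⟨0, by rintro _ ⟨y, rfl⟩; positivity⟩
        (⟨z, hzt⟩ : convexHull ℝ (t : Set (EuclideanSpace ℝ (Fin d))))
  -- the vertex `v` lies on the hyperplane bounding this half-space
  have hvz : inner ℝ (q - z) (v - z) = 0 := by
    obtain ⟨w, hw0, hw1, hwz⟩ := Finset.mem_convexHull'.1 hzs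
    -- A zero weight would put `z` in a smaller face. With all weights positive, nonpositive inner
    -- products averaging to zero must each vanish.
    have hwv : w v ≠ 0 := by
      intro h0
      have hz' : z ∈ convexHull ℝ ((s.erase v : Finset _) : Set (EuclideanSpace ℝ (Fin d))) := by
        refine Finset.mem_convexHull'.2 ⟨w, fun y hy => hw0 y (Finset.mem_of_mem_erase hy), ?_, ?_⟩
        · rw [← hw1, ← Finset.add_sum_erase s w hv, h0, zero_add]
        · rw [← hwz, ← Finset.add_sum_erase s (fun y => w y • y) hv, h0, zero_smul, zero_add]
      have hne' : (s.erase v).Nonempty := by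
        rw [← Finset.coe_nonempty, ← convexHull_nonempty_iff (𝕜 := ℝ)]
        exact ⟨z, hz'⟩
      have hlt := Finset.card_erase_lt_of_mem hv
      have := hmin (j := s.erase v)
        ⟨K.down_closed hs (Finset.erase_subset v s) hne', hz'⟩ hlt.le
      omega
    have hsum : ∑ y ∈ s, w y * inner ℝ (q - z) (y - z) = 0 := by
      have : ∑ y ∈ s, w y • (y - z) = 0 := by
        simp only [smul_sub]
        rw [Finset.sum_sub_distrib, hwz, ← Finset.sum_smul, hw1, one_smul, sub_self]
      calc ∑ y ∈ s, w y * inner ℝ (q - z) (y - z)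
          = inner ℝ (q - z) (∑ y ∈ s, w y • (y - z)) := by
            simp only [inner_sum, inner_smul_right]
        _ = 0 := by rw [this, inner_zero_right]
    have hall := (Finset.sum_eq_zero_iff_of_nonpos fun y hy =>
      mul_nonpos_of_nonneg_of_nonpos (hw0 y hy)
        (hhalf s hs hzs y (subset_convexHull ℝ _ hy))).1 hsum v hv
    exact (mul_eq_zero.1 hall).resolve_left hwv
  have hvf : v ∉ interior K.space := by
    intro hvi
    -- a point `y` of the open segment in the interior of the mesh
    obtain ⟨y, hyseg, hyi⟩ : ∃ y ∈ openSegment ℝ z v, y ∈ interior K.space := by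
      have hcl : v ∈ closure (openSegment ℝ z v) := by
        rw [closure_openSegment]; exact right_mem_segment ℝ z v
      obtain ⟨y, hy1, hy2⟩ := mem_closure_iff.1 hcl _ isOpen_interior hvi
      exact ⟨y, hy2, hy1⟩
    -- The faces are closed and finitely many, so near `y` the mesh consists only of faces through
    -- `y`. These contain `z` and so lie in the half-space, which is impossible around an interior
    -- point `y` on its bounding hyperplane.
    have hfar : ∀ᶠ w in nhds y, ∀ t ∈ K.faces,
        y ∉ convexHull ℝ (t : Set (EuclideanSpace ℝ (Fin d))) →
        w ∉ convexHull ℝ (t : Set (EuclideanSpace ℝ (Fin d))) := by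
      rw [Filter.eventually_all_finite hK.finite]
      intro t ht
      by_cases hyt : y ∈ convexHull ℝ (t : Set (EuclideanSpace ℝ (Fin d)))
      · simp [hyt]
      · have : (convexHull ℝ (t : Set (EuclideanSpace ℝ (Fin d))))ᶜ ∈ nhds y :=
          (t.finite_toSet.isClosed_convexHull ℝ).isOpen_compl.mem_nhds hyt
        filter_upwards [this] with w hw _ using hw
    have hloc : ∀ᶠ w in nhds y, inner ℝ (q - z) (w - z) ≤ 0 := by
      filter_upwards [hfar, mem_interior_iff_mem_nhds.1 hyi] with w hw hwK
      obtain ⟨t, ht, hwt⟩ := Geometry.SimplicialComplex.mem_space_iff.1 hwK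
      have hyt : y ∈ convexHull ℝ (t : Set (EuclideanSpace ℝ (Fin d))) := by
        by_contra h
        exact hw t ht h hwt
      exact hhalf t ht (hface t ht y hyseg hyt) w hwt
    have hy0 : inner ℝ (q - z) (y - z) = 0 := by
      obtain ⟨a, b, ha, hb, hab, rfl⟩ := hyseg
      have e : a • z + b • v - z = b • (v - z) := by
        rw [show a = 1 - b by linarith]; module
      rw [e, inner_smul_right, hvz, mul_zero]
    have hmax : innerSL ℝ (q - z) = 0 := by
      refine eq_zero_of_isMaxOn_interior (A := {w | inner ℝ (q - z) (w - z) ≤ 0}) (x := y) _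
        (mem_interior_iff_mem_nhds.2 hloc) fun w hw => ?_
      simp only [Set.mem_ofPred_eq, inner_sub_right] at hw
      simp only [inner_sub_right] at hy0
      simp only [innerSL_apply_apply]
      linarith
    have h0 : inner ℝ (q - z) (q - z) = (0 : ℝ) := by
      rw [← innerSL_apply_apply ℝ, hmax]; rfl
    have : q = z := sub_eq_zero.1 (inner_self_eq_zero.1 h0)
    exact hq (this ▸ hz)
  refine ⟨v, hK.nodes_frontier v hvK (hK.mem_frontier_meshDomain hvsp hvf), fun y hy => ?_⟩
  obtain ⟨t, ht, hst⟩ := hK.pure s hs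
  have hsub := convexHull_mono (𝕜 := ℝ) (Finset.coe_subset.2 hst)
  have := hK.dist_le_meshSize ht (hsub hzs) (hsub hvs)
  linarith [dist_triangle q z v, hzmin y hy]

/-- A frontier point is a limit of points outside the mesh, to which the previous estimate applies;
`ε` pays for the approximation. -/
theorem IsInscribedMesh.exists_frontier_dist_le (hK : IsInscribedMesh Ω K)
    {z : EuclideanSpace ℝ (Fin d)} (hz : z ∈ frontier (meshDomain K)) {ε : ℝ} (hε : 0 < ε) :
    ∃ v ∈ frontier Ω, dist z v ≤ meshSize K + ε := by
  have hzi : z ∉ interior K.space := by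
    rw [interior_space_eq hK]
    have hopen : IsOpen (meshDomain K) := isOpen_interior
    rw [hopen.frontier_eq] at hz
    exact hz.2
  rw [← Set.mem_compl_iff, ← closure_compl] at hzi
  obtain ⟨q, hq, hzq⟩ := Metric.mem_closure_iff.1 hzi (ε / 2) (by positivity)
  obtain ⟨v, hv, hvd⟩ := hK.exists_frontier_dist_le_of_notMem hq
  refine ⟨v, hv, ?_⟩
  have := hvd z (hK.frontier_meshDomain_subset hz)
  rw [dist_comm q z] at this
  linarith [dist_triangle z q v]

end Mesh

/-! ### Continuous piecewise linear functions -/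

section PiecewiseLinear

variable {d : ℕ} {Ω : Set (EuclideanSpace ℝ (Fin d))}
  {K : Geometry.SimplicialComplex ℝ (EuclideanSpace ℝ (Fin d))}

theorem AffineMap.map_sum_smul {E : Type*} [AddCommGroup E] [Module ℝ E] (l : E →ᵃ[ℝ] ℝ)
    {s : Finset E} {c : E → ℝ} (hc : ∑ v ∈ s, c v = 1) :
    l (∑ v ∈ s, c v • v) = ∑ v ∈ s, c v * l v := by
  have hl : ∀ v, l v = l.linear v + l 0 := fun v => congrFun l.decomp v
  have hs : ∑ v ∈ s, c v * l v = ∑ v ∈ s, (c v * l.linear v + c v * l 0) :=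
    Finset.sum_congr rfl fun v _ => by rw [hl v, mul_add]
  rw [hs, hl, map_sum, Finset.sum_add_distrib, ← Finset.sum_mul, hc, one_mul]
  simp only [map_smul, smul_eq_mul]

/-- Barycentric coordinates of a point of the mesh, with respect to an element containing it. -/
theorem IsInscribedMesh.exists_weights (hK : IsInscribedMesh Ω K)
    {y : EuclideanSpace ℝ (Fin d)} (hy : y ∈ K.space) :
    ∃ (s : Finset (EuclideanSpace ℝ (Fin d))) (c : EuclideanSpace ℝ (Fin d) → ℝ),
      (∀ v ∈ s, v ∈ K.vertices ∧ dist y v ≤ meshSize K) ∧ (∀ v ∈ s, 0 ≤ c v) ∧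
      ∑ v ∈ s, c v = 1 ∧ ∑ v ∈ s, c v • v = y ∧
      ∀ w, IsPiecewiseLinear K w → w y = ∑ v ∈ s, c v * w v := by
  obtain ⟨s, hs, hys⟩ := hK.exists_element hy
  obtain ⟨c, hc0, hc1, hcy⟩ := Finset.mem_convexHull'.1 hys
  refine ⟨s, c, fun v hv => ⟨mem_vertices_of_mem_face hs.1 hv,
    hK.dist_le_meshSize hs hys (subset_convexHull ℝ _ hv)⟩, hc0, hc1, hcy, fun w hw => ?_⟩
  obtain ⟨l, hl⟩ := hw.2 s hs
  rw [hl hys, ← hcy, l.map_sum_smul hc1]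
  exact Finset.sum_congr rfl fun v hv => by rw [hl (subset_convexHull ℝ _ hv)]

theorem IsPiecewiseLinear.add {g w : EuclideanSpace ℝ (Fin d) → ℝ} (hg : IsPiecewiseLinear K g)
    (hw : IsPiecewiseLinear K w) : IsPiecewiseLinear K (fun x => g x + w x) := by
  refine ⟨hg.1.add hw.1, fun s hs => ?_⟩
  obtain ⟨l, hl⟩ := hg.2 s hs
  obtain ⟨m, hm⟩ := hw.2 s hs
  exact ⟨l + m, fun x hx => by simp [hl hx, hm hx]⟩

theorem IsPiecewiseLinear.const_mul {g : EuclideanSpace ℝ (Fin d) → ℝ}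
    (hg : IsPiecewiseLinear K g) (t : ℝ) : IsPiecewiseLinear K (fun x => t * g x) := by
  refine ⟨continuousOn_const.mul hg.1, fun s hs => ?_⟩
  obtain ⟨l, hl⟩ := hg.2 s hs
  exact ⟨t • l, fun x hx => by simp [hl hx]⟩

theorem isPiecewiseLinear_affineMap (l : EuclideanSpace ℝ (Fin d) →ᵃ[ℝ] ℝ) :
    IsPiecewiseLinear K l :=
  ⟨l.continuous_of_finiteDimensional.continuousOn, fun _ _ => ⟨l, fun _ _ => rfl⟩⟩

theorem IsInscribedMesh.le_of_le_vertices (hK : IsInscribedMesh Ω K)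
    {g w : EuclideanSpace ℝ (Fin d) → ℝ} (hg : IsPiecewiseLinear K g)
    (hw : IsPiecewiseLinear K w) (h : ∀ v ∈ K.vertices, g v ≤ w v)
    {y : EuclideanSpace ℝ (Fin d)} (hy : y ∈ K.space) : g y ≤ w y := by
  obtain ⟨s, c, hs, hc0, -, -, hpl⟩ := hK.exists_weights hy
  rw [hpl g hg, hpl w hw]
  exact Finset.sum_le_sum fun v hv => mul_le_mul_of_nonneg_left (h v (hs v hv).1) (hc0 v hv)

/-- An affine function with prescribed values at the vertices of an element. -/
theorem exists_affineMap_eq_on_element {s : Finset (EuclideanSpace ℝ (Fin d))}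
    (hs : s ∈ meshElements K) (a : EuclideanSpace ℝ (Fin d) → ℝ) :
    ∃ l : EuclideanSpace ℝ (Fin d) →ᵃ[ℝ] ℝ, ∀ v ∈ s, l v = a v := by
  classical
  have h := K.indep hs.1
  have h2 := h.affineSpan_eq_top_iff_card_eq_finrank_add_one.2 (by simp [hs.2])
  let b : AffineBasis s ℝ (EuclideanSpace ℝ (Fin d)) := ⟨(↑), h, h2⟩
  let L : EuclideanSpace ℝ (Fin d) →ᵃ[ℝ] (s → ℝ) := AffineMap.pi fun i => b.coord i
  let m : (s → ℝ) →ₗ[ℝ] ℝ := ∑ i : s, a i • LinearMap.proj i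
  refine ⟨m.toAffineMap.comp L, fun v hv => ?_⟩
  have hb : ∀ i : s, b.coord i v = if i = ⟨v, hv⟩ then 1 else 0 := fun i =>
    b.coord_apply i ⟨v, hv⟩
  simp [m, L, hb]

/-- Piecewise linear interpolation of nodal values. -/
theorem IsInscribedMesh.exists_interpolant (hK : IsInscribedMesh Ω K)
    (a : EuclideanSpace ℝ (Fin d) → ℝ) :
    ∃ g, IsPiecewiseLinear K g ∧ ∀ v ∈ K.vertices, g v = a v := by
  classical
  choose! l hl using fun s (hs : s ∈ meshElements K) => exists_affineMap_eq_on_element hs a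
  choose! e he using fun y (hy : y ∈ K.space) => hK.exists_element hy
  -- Conformity: two elements meet in the hull of their common vertices, where both affine pieces
  -- are fixed by the same nodal values.
  have hcompat : ∀ s ∈ meshElements K, ∀ t ∈ meshElements K,
      ∀ y ∈ convexHull ℝ (s : Set (EuclideanSpace ℝ (Fin d))),
      y ∈ convexHull ℝ (t : Set (EuclideanSpace ℝ (Fin d))) → l s y = l t y := by
    intro s hs t ht y hys hyt
    have hy := K.inter_subset_convexHull hs.1 ht.1 ⟨hys, hyt⟩
    rw [← Finset.coe_inter] at hy
    obtain ⟨c, -, hc1, rfl⟩ := Finset.mem_convexHull'.1 hy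
    rw [(l s).map_sum_smul hc1, (l t).map_sum_smul hc1]
    refine Finset.sum_congr rfl fun v hv => ?_
    rw [hl s hs v (Finset.mem_inter.1 hv).1, hl t ht v (Finset.mem_inter.1 hv).2]
  have heq : ∀ s ∈ meshElements K, Set.EqOn (fun y => l (e y) y) (l s)
      (convexHull ℝ (s : Set (EuclideanSpace ℝ (Fin d)))) := by
    intro s hs y hy
    have hyK := Geometry.SimplicialComplex.convexHull_subset_space hs.1 hy
    exact hcompat _ (he y hyK).1 s hs y (he y hyK).2 hy
  refine ⟨fun y => l (e y) y, ⟨?_, fun s hs => ⟨l s, heq s hs⟩⟩, fun v hv => ?_⟩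
  · rw [hK.closure_meshDomain, hK.space_eq, Set.biUnion_eq_iUnion]
    have : Finite (meshElements K) := hK.finite.subset fun s hs => hs.1
    refine (locallyFinite_of_finite _).continuousOn_iUnion
      (fun s => s.1.finite_toSet.isClosed_convexHull ℝ) fun s => ?_
    exact (l s.1).continuous_of_finiteDimensional.continuousOn.congr (heq s.1 s.2)
  · obtain ⟨t, ht, hvt⟩ := hK.pure {v} hv
    have hvt' : v ∈ t := hvt (Finset.mem_singleton_self v)
    have := heq t ht (subset_convexHull ℝ _ (Finset.mem_coe.2 hvt'))
    exact this.trans (hl t ht v hvt')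

/-- Barycentric averages of a squared distance. -/
theorem sum_mul_sq_norm_sub {E : Type*} [NormedAddCommGroup E] [InnerProductSpace ℝ E]
    {s : Finset E} {c : E → ℝ} (hc : ∑ v ∈ s, c v = 1) (p : E) :
    ∑ v ∈ s, c v * ‖v - p‖ ^ 2 = ‖∑ v ∈ s, c v • v - p‖ ^ 2 +
      ∑ v ∈ s, c v * ‖v - ∑ v ∈ s, c v • v‖ ^ 2 := by
  set y := ∑ v ∈ s, c v • v with hy
  have h1 : ∀ v, c v * ‖v - p‖ ^ 2 =
      c v * ‖y - p‖ ^ 2 + c v * ‖v - y‖ ^ 2 + 2 * (c v * inner ℝ (v - y) (y - p)) := by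
    intro v
    rw [show v - p = (v - y) + (y - p) by abel, norm_add_sq_real]
    ring
  have h2 : ∑ v ∈ s, c v * inner ℝ (v - y) (y - p) = 0 := by
    have : ∑ v ∈ s, c v • (v - y) = 0 := by
      simp only [smul_sub]
      rw [Finset.sum_sub_distrib, ← hy, ← Finset.sum_smul, hc, one_smul, sub_self]
    calc ∑ v ∈ s, c v * inner ℝ (v - y) (y - p)
        = inner ℝ (∑ v ∈ s, c v • (v - y)) (y - p) := by
          simp only [sum_inner, real_inner_smul_left]
      _ = 0 := by rw [this, inner_zero_left]
  rw [Finset.sum_congr rfl fun v _ => h1 v, Finset.sum_add_distrib, Finset.sum_add_distrib,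
    ← Finset.mul_sum, h2, ← Finset.sum_mul, hc]
  ring

end PiecewiseLinear

/-! ### Discrete subsolutions, comparison and existence -/

section Discrete

variable {d : ℕ} {Ω : Set (EuclideanSpace ℝ (Fin d))}
  {K : Geometry.SimplicialComplex ℝ (EuclideanSpace ℝ (Fin d))}
  {f : EuclideanSpace ℝ (Fin d) → ℝ} {δ : ℝ} {S : Finset (EuclideanSpace ℝ (Fin d))}

/-- Discrete subsolutions of the two-scale method, with the second differences cleared of
denominators. -/
structure IsTwoScaleSubsolution (Ω : Set (EuclideanSpace ℝ (Fin d)))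
    (f : EuclideanSpace ℝ (Fin d) → ℝ)
    (K : Geometry.SimplicialComplex ℝ (EuclideanSpace ℝ (Fin d)))
    (δ : ℝ) (S : Finset (EuclideanSpace ℝ (Fin d)))
    (w : EuclideanSpace ℝ (Fin d) → ℝ) : Prop where
  piecewiseLinear : IsPiecewiseLinear K w
  le_obstacle : ∀ x ∈ K.vertices, w x ≤ f x
  le_average : ∀ x ∈ interiorNodes Ω K, ∀ v ∈ S,
    2 * w x ≤ w (x + localScale K δ x • v) + w (x - localScale K δ x • v)

/-- Over an empty index type the real infimum is 0, and the operator would then retain only the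
obstacle. -/
theorem IsDirectionSet.nonempty {θ : ℝ} (hd : 1 ≤ d) (hS : IsDirectionSet θ S) : S.Nonempty := by
  obtain ⟨v, hv, -⟩ := hS.2 (EuclideanSpace.single ⟨0, hd⟩ 1) (by simp)
  exact ⟨v, hv⟩

/-- The two signs of the operator are used separately: nonnegativity makes all constraints hold,
nonpositivity makes one of them tight or reversed. -/
theorem IsInscribedMesh.twoScaleOperator_nonneg_iff (hd : 1 ≤ d) (hK : IsInscribedMesh Ω K)
    (hδ : 0 < δ) (hS : S.Nonempty) {w : EuclideanSpace ℝ (Fin d) → ℝ}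
    {x : EuclideanSpace ℝ (Fin d)} (hx : x ∈ interiorNodes Ω K) :
    0 ≤ twoScaleOperator K δ S f w x ↔ w x ≤ f x ∧ ∀ v ∈ S,
      2 * w x ≤ w (x + localScale K δ x • v) + w (x - localScale K δ x • v) := by
  have : Nonempty S := hS.to_subtype
  have h := pow_pos (hK.localScale_pos hd hδ hx) 2
  rw [twoScaleOperator, le_min_iff, sub_nonneg, le_ciInf_iff (Set.finite_range _).bddBelow]
  simp only [secondDifference, le_div_iff₀ h, zero_mul, Subtype.forall]
  refine and_congr Iff.rfl (forall₂_congr fun v _ => ?_)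
  constructor <;> intro h <;> linarith

theorem IsInscribedMesh.twoScaleOperator_nonpos_iff (hd : 1 ≤ d) (hK : IsInscribedMesh Ω K)
    (hδ : 0 < δ) (hS : S.Nonempty) {w : EuclideanSpace ℝ (Fin d) → ℝ}
    {x : EuclideanSpace ℝ (Fin d)} (hx : x ∈ interiorNodes Ω K) :
    twoScaleOperator K δ S f w x ≤ 0 ↔ f x ≤ w x ∨ ∃ v ∈ S,
      w (x + localScale K δ x • v) + w (x - localScale K δ x • v) ≤ 2 * w x := by
  have : Nonempty S := hS.to_subtype
  have h := pow_pos (hK.localScale_pos hd hδ hx) 2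
  rw [twoScaleOperator, min_le_iff, sub_nonpos]
  refine or_congr Iff.rfl ?_
  have hsd : ∀ v, secondDifference K δ w x v ≤ 0 ↔
      w (x + localScale K δ x • v) + w (x - localScale K δ x • v) ≤ 2 * w x := by
    intro v
    rw [secondDifference, div_le_iff₀ h, zero_mul]
    constructor <;> intro h <;> linarith
  constructor
  · intro hle
    obtain ⟨v, hv⟩ := exists_eq_ciInf_of_finite
      (f := fun v : S => secondDifference K δ w x (v : EuclideanSpace ℝ (Fin d)))
    exact ⟨v, v.2, (hsd v).1 (hv ▸ hle)⟩
  · rintro ⟨v, hv, hle⟩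
    exact (ciInf_le (Set.finite_range _).bddBelow (⟨v, hv⟩ : S)).trans ((hsd v).2 hle)

theorem IsTwoScaleSolution.isSubsolution (hd : 1 ≤ d) (hK : IsInscribedMesh Ω K)
    (hδ : 0 < δ) (hS : S.Nonempty) {u : EuclideanSpace ℝ (Fin d) → ℝ}
    (hu : IsTwoScaleSolution Ω f K δ S u) : IsTwoScaleSubsolution Ω f K δ S u := by
  have h := fun x hx => (hK.twoScaleOperator_nonneg_iff hd hδ hS (w := u) (f := f) hx).1
    (hu.operator_eq x hx).ge
  refine ⟨hu.piecewiseLinear, fun x hx => ?_, fun x hx => (h x hx).2⟩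
  by_cases hxb : x ∈ boundaryNodes Ω K
  · exact (hu.boundary_eq x hxb).le
  · exact (h x ⟨hx, hxb⟩).1

/-- Discrete comparison principle. -/
theorem IsTwoScaleSubsolution.le_solution (hd : 1 ≤ d) (hK : IsInscribedMesh Ω K)
    (hδ : 0 < δ) (hS : S.Nonempty) (hS1 : ∀ v ∈ S, ‖v‖ = 1)
    {w u : EuclideanSpace ℝ (Fin d) → ℝ}
    (hw : IsTwoScaleSubsolution Ω f K δ S w) (hu : IsTwoScaleSolution Ω f K δ S u)
    {y : EuclideanSpace ℝ (Fin d)} (hy : y ∈ K.space) : w y ≤ u y := by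
  refine hK.le_of_le_vertices hw.piecewiseLinear hu.piecewiseLinear ?_ hy
  intro z hz
  by_contra! hlt
  obtain ⟨R, hR⟩ := (hK.vertices_finite.image fun v => ‖v‖ ^ 2).bddAbove
  have hR' : ∀ v ∈ K.vertices, ‖v‖ ^ 2 ≤ R := fun v hv => hR (Set.mem_image_of_mem _ hv)
  have hR0 : 0 ≤ R := (sq_nonneg _).trans (hR' z hz)
  -- The term `ε |·|²` makes the comparison strict, and `ε` is small enough that `w - u` stays
  -- positive at the perturbed maximum.
  obtain ⟨ε, hε, hεR⟩ : ∃ ε : ℝ, 0 < ε ∧ ε * R < w z - u z := by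
    refine ⟨(w z - u z) / (R + 1), by apply div_pos <;> linarith, ?_⟩
    rw [div_mul_eq_mul_div, div_lt_iff₀ (by linarith)]
    nlinarith
  obtain ⟨x, hx, hxmax⟩ := hK.vertices_finite.exists_maximalFor
    (fun v => w v - u v + ε * ‖v‖ ^ 2) _ hK.vertices_nonempty
  have hmax : ∀ v ∈ K.vertices, w v - u v + ε * ‖v‖ ^ 2 ≤ w x - u x + ε * ‖x‖ ^ 2 := by
    intro v hv
    rcases le_total (w v - u v + ε * ‖v‖ ^ 2) (w x - u x + ε * ‖x‖ ^ 2) with h | h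
    · exact h
    · exact hxmax hv h
  have hpos : u x < w x := by
    have h1 := hmax z hz
    have h2 := mul_le_mul_of_nonneg_left (hR' x hx) hε.le
    have h3 := mul_nonneg hε.le (sq_nonneg ‖z‖)
    linarith
  have hxi : x ∈ interiorNodes Ω K := by
    refine ⟨hx, fun hxb => ?_⟩
    have := hu.boundary_eq x hxb
    linarith [hw.le_obstacle x hx]
  -- The nodal bound extends to the whole mesh because, by convexity, the interpolant of `|·|²` lies
  -- above `|·|²`.
  have hbound : ∀ y ∈ K.space, w y - u y ≤ w x - u x + ε * ‖x‖ ^ 2 - ε * ‖y‖ ^ 2 := by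
    intro y hy
    obtain ⟨s, c, hs, hc0, hc1, hcy, hpl⟩ := hK.exists_weights hy
    rw [hpl w hw.piecewiseLinear, hpl u hu.piecewiseLinear, ← Finset.sum_sub_distrib]
    have hsq := sum_mul_sq_norm_sub hc1 (0 : EuclideanSpace ℝ (Fin d))
    simp only [sub_zero, hcy] at hsq
    have hnn : 0 ≤ ∑ v ∈ s, c v * ‖v - y‖ ^ 2 :=
      Finset.sum_nonneg fun v hv => mul_nonneg (hc0 v hv) (sq_nonneg _)
    calc ∑ v ∈ s, (c v * w v - c v * u v)
        ≤ ∑ v ∈ s, (c v * (w x - u x + ε * ‖x‖ ^ 2) - ε * (c v * ‖v‖ ^ 2)) := by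
          refine Finset.sum_le_sum fun v hv => ?_
          nlinarith [mul_le_mul_of_nonneg_left (hmax v (hs v hv).1) (hc0 v hv)]
      _ = w x - u x + ε * ‖x‖ ^ 2 - ε * ∑ v ∈ s, c v * ‖v‖ ^ 2 := by
          rw [Finset.sum_sub_distrib, ← Finset.sum_mul, hc1, one_mul, Finset.mul_sum]
      _ ≤ _ := by rw [hsq]; nlinarith
  rcases (hK.twoScaleOperator_nonpos_iff hd hδ hS hxi).1 (hu.operator_eq x hxi).le with h | ⟨v, hv, h⟩
  · linarith [hw.le_obstacle x hx]
  · have h1 := hw.le_average x hxi v hv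
    have hmem := hK.add_smul_mem_space hd hδ hxi (hS1 v hv)
    have h2 := hbound _ hmem.1
    have h3 := hbound _ hmem.2
    -- The second difference of `w - u` along `v` is at least 0, while `hbound` gives at most `-2ε`:
    -- a contradiction.
    have hpar := parallelogram_law_with_norm ℝ x (localScale K δ x • v)
    have hsc := hK.localScale_pos hd hδ hxi
    rw [norm_smul, hS1 v hv, Real.norm_of_nonneg hsc.le] at hpar
    have := mul_pos hε (mul_pos hsc hsc)
    nlinarith

/-- Perron's method: the discrete problem has a solution. -/
theorem IsInscribedMesh.exists_twoScaleSolution (hd : 1 ≤ d) (hK : IsInscribedMesh Ω K)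
    (hδ : 0 < δ) (hS : S.Nonempty) (hS1 : ∀ v ∈ S, ‖v‖ = 1)
    (f : EuclideanSpace ℝ (Fin d) → ℝ) :
    ∃ u, IsTwoScaleSolution Ω f K δ S u := by
  classical
  have hmem : ∀ x ∈ interiorNodes Ω K, ∀ v ∈ S, _ := fun x hx v hv =>
    hK.add_smul_mem_space hd hδ hx (hS1 v hv)
  let V (x : EuclideanSpace ℝ (Fin d)) : Set ℝ :=
    {t | ∃ w, IsTwoScaleSubsolution Ω f K δ S w ∧ w x = t}
  obtain ⟨m, hm⟩ := (hK.vertices_finite.image f).bddBelow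
  have hconst : IsTwoScaleSubsolution Ω f K δ S
      (AffineMap.const ℝ (EuclideanSpace ℝ (Fin d)) m) :=
    ⟨isPiecewiseLinear_affineMap _, fun x hx => hm (Set.mem_image_of_mem _ hx),
      fun x _ v _ => by simp [two_mul]⟩
  have hVne : ∀ x, (V x).Nonempty := fun x => ⟨_, _, hconst, rfl⟩
  have hVbdd : ∀ x ∈ K.vertices, BddAbove (V x) := by
    rintro x hx
    refine ⟨f x, ?_⟩
    rintro _ ⟨w, hw, rfl⟩
    exact hw.le_obstacle x hx
  -- The Perron candidate interpolates the nodal suprema of all subsolutions.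
  obtain ⟨u, hupl, hun⟩ := hK.exists_interpolant fun x => sSup (V x)
  have hwu : ∀ w, IsTwoScaleSubsolution Ω f K δ S w → ∀ x ∈ K.space, w x ≤ u x := by
    intro w hw x hx
    refine hK.le_of_le_vertices hw.piecewiseLinear hupl (fun v hv => ?_) hx
    rw [hun v hv]
    exact le_csSup (hVbdd v hv) ⟨w, hw, rfl⟩
  have husub : IsTwoScaleSubsolution Ω f K δ S u := by
    refine ⟨hupl, fun x hx => ?_, fun x hx v hv => ?_⟩
    · rw [hun x hx]
      refine csSup_le (hVne x) ?_
      rintro _ ⟨w, hw, rfl⟩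
      exact hw.le_obstacle x hx
    · rw [hun x hx.1, ← le_div_iff₀' two_pos]
      refine csSup_le (hVne x) ?_
      rintro _ ⟨w, hw, rfl⟩
      rw [le_div_iff₀' two_pos]
      exact (hw.le_average x hx v hv).trans
        (add_le_add (hwu w hw _ (hmem x hx v hv).1) (hwu w hw _ (hmem x hx v hv).2))
  -- the value at one node cannot be raised
  have hraise : ∀ x ∈ K.vertices, ∀ t : ℝ, 0 < t → u x + t ≤ f x →
      (x ∈ interiorNodes Ω K → ∀ v ∈ S,
        2 * (u x + t) ≤ u (x + localScale K δ x • v) + u (x - localScale K δ x • v)) →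
      False := by
    intro x hx t ht hf hi
    obtain ⟨g, hgpl, hgn⟩ := hK.exists_interpolant fun y => if y = x then 1 else 0
    have hgnn : ∀ y ∈ K.space, 0 ≤ g y := by
      intro y hy
      refine hK.le_of_le_vertices
        (isPiecewiseLinear_affineMap (AffineMap.const ℝ _ (0 : ℝ))) hgpl (fun v hv => ?_) hy
      rw [hgn v hv]
      split_ifs <;> simp
    -- Adding a nonnegative hat function only raises the averages, so the constraints at the other
    -- nodes survive.
    have hsub : IsTwoScaleSubsolution Ω f K δ S (fun y => u y + t * g y) := by
      refine ⟨hupl.add (hgpl.const_mul t), fun y hy => ?_, fun y hy v hv => ?_⟩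
      · rw [hgn y hy]
        split_ifs with h
        · subst h; linarith
        · linarith [husub.le_obstacle y hy]
      · have h1 := mul_nonneg ht.le (hgnn _ (hmem y hy v hv).1)
        have h2 := mul_nonneg ht.le (hgnn _ (hmem y hy v hv).2)
        rw [hgn y hy.1]
        split_ifs with h
        · subst h; linarith [hi hy v hv]
        · linarith [husub.le_average y hy v hv]
    have := hwu _ hsub x (Geometry.SimplicialComplex.vertices_subset_space hx)
    simp only [hgn x hx, if_true] at this
    linarith
  refine ⟨u, hupl, fun x hx => le_antisymm ?_ ?_, fun x hx => ?_⟩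
  · rw [hK.twoScaleOperator_nonpos_iff hd hδ hS hx]
    by_contra! h
    -- If every constraint is strict, finiteness of `S` leaves a least slack by which the nodal
    -- value could be raised.
    obtain ⟨v₀, hv₀, hv₀min⟩ := S.exists_min_image
      (fun v => (u (x + localScale K δ x • v) + u (x - localScale K δ x • v)) / 2 - u x) hS
    refine hraise x hx.1 (min (f x - u x) ((u (x + localScale K δ x • v₀)
      + u (x - localScale K δ x • v₀)) / 2 - u x)) (lt_min (by linarith) ?_) ?_ ?_
    · linarith [h.2 v₀ hv₀]
    · linarith [min_le_left (f x - u x) ((u (x + localScale K δ x • v₀)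
        + u (x - localScale K δ x • v₀)) / 2 - u x)]
    · intro _ v hv
      have := hv₀min v hv
      linarith [min_le_right (f x - u x) ((u (x + localScale K δ x • v₀)
        + u (x - localScale K δ x • v₀)) / 2 - u x)]
  · exact (hK.twoScaleOperator_nonneg_iff hd hδ hS hx).2
      ⟨husub.le_obstacle x hx.1, husub.le_average x hx⟩
  · by_contra hne
    have hlt := lt_of_le_of_ne (husub.le_obstacle x hx.1) hne
    refine hraise x hx.1 (f x - u x) (by linarith) (by linarith) fun hxi => ?_
    exact absurd hx hxi.2

theorem IsTwoScaleSolution.eqOn (hd : 1 ≤ d) (hK : IsInscribedMesh Ω K)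
    (hδ : 0 < δ) (hS : S.Nonempty) (hS1 : ∀ v ∈ S, ‖v‖ = 1)
    {w u : EuclideanSpace ℝ (Fin d) → ℝ}
    (hw : IsTwoScaleSolution Ω f K δ S w) (hu : IsTwoScaleSolution Ω f K δ S u) :
    Set.EqOn w u K.space := fun _ hy => le_antisymm
  ((hw.isSubsolution hd hK hδ hS).le_solution hd hK hδ hS hS1 hu hy)
  ((hu.isSubsolution hd hK hδ hS).le_solution hd hK hδ hS hS1 hw hy)

end Discrete

/-! ### The convex envelope -/

/-- In finite dimension, the convex hull of a compact set is compact. -/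
theorem IsCompact.isCompact_convexHull {E : Type*} [NormedAddCommGroup E] [NormedSpace ℝ E]
    [FiniteDimensional ℝ E] {C : Set E} (hC : IsCompact C) : IsCompact (convexHull ℝ C) := by
  let g (k : ℕ) (p : (Fin k → ℝ) × (Fin k → E)) : E := ∑ i, p.1 i • p.2 i
  let B (k : ℕ) : Set ((Fin k → ℝ) × (Fin k → E)) :=
    stdSimplex ℝ (Fin k) ×ˢ Set.pi Set.univ fun _ => C
  -- By Carathéodory, at most `finrank + 1` points suffice, so the hull is a finite union of
  -- continuous images of compact sets.
  have heq : convexHull ℝ C =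
      ⋃ k ∈ Set.Iic (Module.finrank ℝ E + 1), g k '' B k := by
    apply subset_antisymm
    · intro x hx
      obtain ⟨ι, _, z, w, hz, hind, hw0, hw1, rfl⟩ := eq_pos_convex_span_of_mem_convexHull hx
      refine Set.mem_biUnion (x := Fintype.card ι)
        (hind.card_le_finrank_succ.trans (Nat.succ_le_succ (Submodule.finrank_le _))) ?_
      let e := Fintype.equivFin ι
      refine ⟨(w ∘ e.symm, z ∘ e.symm), ⟨⟨fun i => (hw0 _).le, ?_⟩, fun i _ => hz ⟨_, rfl⟩⟩, ?_⟩
      · rw [← hw1]; exact e.symm.sum_comp w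
      · exact e.symm.sum_comp fun i => w i • z i
    · refine Set.iUnion₂_subset fun k _ => ?_
      rintro _ ⟨⟨w, z⟩, ⟨hw, hz⟩, rfl⟩
      exact (convex_convexHull ℝ C).sum_mem (fun i _ => hw.1 i) hw.2
        fun i _ => subset_convexHull ℝ C (hz i trivial)
  rw [heq]
  refine (Set.finite_Iic _).isCompact_biUnion fun k _ => ?_
  refine ((isCompact_stdSimplex ℝ (Fin k)).prod (isCompact_univ_pi fun _ => hC)).image ?_
  fun_prop

section Envelope

variable {d : ℕ} {Ω : Set (EuclideanSpace ℝ (Fin d))} {f : EuclideanSpace ℝ (Fin d) → ℝ}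

theorem IsStrictlyConvexDomain.isCompact_closure (hΩ : IsStrictlyConvexDomain Ω) :
    IsCompact (closure Ω) :=
  hΩ.isBounded.isCompact_closure

theorem IsStrictlyConvexDomain.exists_bound (hΩ : IsStrictlyConvexDomain Ω)
    (hf : ContinuousOn f (closure Ω)) : ∃ M : ℝ, 0 ≤ M ∧ ∀ y ∈ closure Ω, |f y| ≤ M := by
  obtain ⟨M, hM⟩ := hΩ.isCompact_closure.exists_bound_of_continuousOn hf
  exact ⟨max M 0, le_max_right _ _, fun y hy => (hM y hy).trans (le_max_left _ _)⟩

theorem le_convexEnvelope {x : EuclideanSpace ℝ (Fin d)} (hx : x ∈ closure Ω)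
    {l : EuclideanSpace ℝ (Fin d) →ᵃ[ℝ] ℝ} (hl : ∀ y ∈ closure Ω, l y ≤ f y) :
    l x ≤ convexEnvelope Ω f x := by
  refine le_csSup ⟨f x, ?_⟩ ⟨l, hl, rfl⟩
  rintro _ ⟨m, hm, rfl⟩
  exact hm x hx

theorem IsStrictlyConvexDomain.convexEnvelope_le_of_forall (hΩ : IsStrictlyConvexDomain Ω)
    (hf : ContinuousOn f (closure Ω)) {x : EuclideanSpace ℝ (Fin d)} {t : ℝ}
    (h : ∀ l : EuclideanSpace ℝ (Fin d) →ᵃ[ℝ] ℝ, (∀ y ∈ closure Ω, l y ≤ f y) → l x ≤ t) :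
    convexEnvelope Ω f x ≤ t := by
  obtain ⟨M, -, hM⟩ := hΩ.exists_bound hf
  refine csSup_le ⟨_, AffineMap.const ℝ _ (-M), fun y hy => (abs_le.1 (hM y hy)).1, rfl⟩ ?_
  rintro _ ⟨l, hl, rfl⟩
  exact h l hl

theorem IsStrictlyConvexDomain.convexEnvelope_le (hΩ : IsStrictlyConvexDomain Ω)
    (hf : ContinuousOn f (closure Ω)) {x : EuclideanSpace ℝ (Fin d)} (hx : x ∈ closure Ω) :
    convexEnvelope Ω f x ≤ f x :=
  hΩ.convexEnvelope_le_of_forall hf fun _ hl => hl x hx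

theorem IsStrictlyConvexDomain.convexOn_convexEnvelope (hΩ : IsStrictlyConvexDomain Ω)
    (hf : ContinuousOn f (closure Ω)) : ConvexOn ℝ (closure Ω) (convexEnvelope Ω f) := by
  refine ⟨hΩ.convex.closure, fun x hx y hy a b ha hb hab => ?_⟩
  refine hΩ.convexEnvelope_le_of_forall hf fun l hl => ?_
  rw [Convex.combo_affine_apply hab]
  exact add_le_add (mul_le_mul_of_nonneg_left (le_convexEnvelope hx hl) ha)
    (mul_le_mul_of_nonneg_left (le_convexEnvelope hy hl) hb)

/-- By strict convexity, at a boundary point there are affine minorants of `f` nearly touching. -/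
theorem IsStrictlyConvexDomain.exists_barrier (hΩ : IsStrictlyConvexDomain Ω)
    (hf : ContinuousOn f (closure Ω)) {z : EuclideanSpace ℝ (Fin d)} (hz : z ∈ frontier Ω)
    {η : ℝ} (hη : 0 < η) :
    ∃ l : EuclideanSpace ℝ (Fin d) →ᵃ[ℝ] ℝ, (∀ y ∈ closure Ω, l y ≤ f y) ∧ l z = f z - η := by
  have hzc : z ∈ closure Ω := frontier_subset_closure hz
  have hzΩ : z ∉ Ω := by
    rw [hΩ.isOpen.frontier_eq] at hz
    exact hz.2
  obtain ⟨m, hm⟩ := geometric_hahn_banach_open_point hΩ.convex hΩ.isOpen hzΩ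
  have hint : interior (closure Ω) = Ω := by
    rw [hΩ.convex.interior_closure_eq_interior_of_nonempty_interior
      (hΩ.isOpen.interior_eq.symm ▸ hΩ.nonempty), hΩ.isOpen.interior_eq]
  -- The midpoint of `y` and `z` lies in `Ω` by strict convexity, so the separation is strict away
  -- from `z`.
  have hmlt : ∀ y ∈ closure Ω, y ≠ z → m y < m z := by
    intro y hy hyz
    have := hΩ.strictConvex_closure hy hzc hyz (a := 1 / 2) (b := 1 / 2) (by norm_num)
      (by norm_num) (by norm_num)
    rw [hint] at this
    have := hm _ this
    simp only [map_add, map_smul, smul_eq_mul] at this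
    linarith
  have hmle : ∀ y ∈ closure Ω, m y ≤ m z := by
    intro y hy
    by_cases h : y = z
    · rw [h]
    · exact (hmlt y hy h).le
  obtain ⟨M, hM0, hM⟩ := hΩ.exists_bound hf
  -- On the compact set where `f` is too low, `m` stays below `m z` by a gap `c`. Slope `2M/c` then
  -- brings the barrier below `-M` there.
  obtain ⟨c, hc, hcA⟩ : ∃ c : ℝ, 0 < c ∧ ∀ y ∈ closure Ω, f y ≤ f z - η → c ≤ m z - m y := by
    have hA : IsCompact (closure Ω ∩ f ⁻¹' Set.Iic (f z - η)) :=
      hΩ.isCompact_closure.of_isClosed_subset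
        (hf.preimage_isClosed_of_isClosed isClosed_closure isClosed_Iic) Set.inter_subset_left
    rcases (closure Ω ∩ f ⁻¹' Set.Iic (f z - η)).eq_empty_or_nonempty with h | h
    · refine ⟨1, one_pos, fun y hy hfy => ?_⟩
      have : y ∈ closure Ω ∩ f ⁻¹' Set.Iic (f z - η) := ⟨hy, hfy⟩
      rw [h] at this
      exact this.elim
    · obtain ⟨y, hy, hymin⟩ := hA.exists_isMinOn h
        (f := fun y => m z - m y) (by fun_prop)
      refine ⟨m z - m y, ?_, fun w hw hfw => hymin ⟨hw, hfw⟩⟩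
      refine sub_pos.2 (hmlt y hy.1 ?_)
      rintro rfl
      have := hy.2
      simp only [Set.mem_preimage, Set.mem_Iic] at this
      linarith
  refine ⟨(2 * M / c) • (m.toLinearMap.toAffineMap - AffineMap.const ℝ _ (m z))
    + AffineMap.const ℝ _ (f z - η), fun y hy => ?_, by simp⟩
  have hC : 0 ≤ 2 * M / c := by positivity
  simp only [AffineMap.coe_add, AffineMap.coe_smul, AffineMap.coe_sub, Pi.add_apply,
    Pi.smul_apply, Pi.sub_apply, LinearMap.coe_toAffineMap, AffineMap.const_apply, smul_eq_mul,
    ContinuousLinearMap.coe_coe]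
  by_cases hfy : f y ≤ f z - η
  · have h1 := mul_le_mul_of_nonneg_left (hcA y hy hfy) hC
    rw [div_mul_cancel₀ _ hc.ne'] at h1
    linarith [(abs_le.1 (hM y hy)).1, (abs_le.1 (hM z hzc)).2]
  · have h1 := mul_nonneg hC (sub_nonneg.2 (hmle y hy))
    linarith

theorem IsStrictlyConvexDomain.convexEnvelope_eq_of_mem_frontier (hΩ : IsStrictlyConvexDomain Ω)
    (hf : ContinuousOn f (closure Ω)) {z : EuclideanSpace ℝ (Fin d)} (hz : z ∈ frontier Ω) :
    convexEnvelope Ω f z = f z := by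
  have hzc : z ∈ closure Ω := frontier_subset_closure hz
  refine le_antisymm (hΩ.convexEnvelope_le hf hzc) (le_of_forall_pos_le_add fun η hη => ?_)
  obtain ⟨l, hl, hlz⟩ := hΩ.exists_barrier hf hz hη
  linarith [le_convexEnvelope hzc hl]

/-- Inside, a convex function on an open set is continuous. At the boundary the envelope is squeezed
between a barrier and `f`. -/
theorem IsStrictlyConvexDomain.continuousOn_convexEnvelope (hΩ : IsStrictlyConvexDomain Ω)
    (hf : ContinuousOn f (closure Ω)) : ContinuousOn (convexEnvelope Ω f) (closure Ω) := by
  intro z hz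
  by_cases hzΩ : z ∈ Ω
  · exact (((hΩ.convexOn_convexEnvelope hf).subset subset_closure hΩ.convex).continuousOn
      hΩ.isOpen |>.continuousAt (hΩ.isOpen.mem_nhds hzΩ)).continuousWithinAt
  · have hzf : z ∈ frontier Ω := by
      rw [hΩ.isOpen.frontier_eq]; exact ⟨hz, hzΩ⟩
    have hmem : ∀ᶠ y in nhdsWithin z (closure Ω), y ∈ closure Ω := self_mem_nhdsWithin
    refine tendsto_order.2 ⟨fun a ha => ?_, fun a ha => ?_⟩
    · rw [hΩ.convexEnvelope_eq_of_mem_frontier hf hzf] at ha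
      obtain ⟨l, hl, hlz⟩ := hΩ.exists_barrier hf hzf (η := (f z - a) / 2) (by linarith)
      have hlc : ContinuousWithinAt l (closure Ω) z :=
        l.continuous_of_finiteDimensional.continuousWithinAt
      filter_upwards [hmem, (tendsto_order.1 hlc).1 a (by rw [hlz]; linarith)] with y hy hay
      exact hay.trans_le (le_convexEnvelope hy hl)
    · rw [hΩ.convexEnvelope_eq_of_mem_frontier hf hzf] at ha
      filter_upwards [hmem, (tendsto_order.1 (hf z hz)).2 a ha] with y hy hay
      exact (hΩ.convexEnvelope_le hf hy).trans_lt hay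

/-- The envelope has a supporting affine function at each point of the domain. -/
theorem IsStrictlyConvexDomain.exists_support (hΩ : IsStrictlyConvexDomain Ω)
    (hf : ContinuousOn f (closure Ω)) {x : EuclideanSpace ℝ (Fin d)} (hx : x ∈ Ω) :
    ∃ l : EuclideanSpace ℝ (Fin d) →ᵃ[ℝ] ℝ, (∀ y ∈ closure Ω, l y ≤ f y) ∧
      l x = convexEnvelope Ω f x := by
  set u := convexEnvelope Ω f with hu
  have huc : ConvexOn ℝ Ω u :=
    (hΩ.convexOn_convexEnvelope hf).subset subset_closure hΩ.convex
  have hucont : ContinuousOn u Ω := huc.continuousOn hΩ.isOpen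
  have hopen : IsOpen {p : EuclideanSpace ℝ (Fin d) × ℝ | p.1 ∈ Ω ∧ u p.1 < p.2} := by
    have h1 : ContinuousOn (fun p : EuclideanSpace ℝ (Fin d) × ℝ => p.2 - u p.1)
        (Prod.fst ⁻¹' Ω) :=
      continuousOn_snd.sub (hucont.comp continuousOn_fst fun p hp => hp)
    have h2 := h1.isOpen_inter_preimage (hΩ.isOpen.preimage continuous_fst) (isOpen_Ioi (a := 0))
    convert h2 using 1
    ext p
    simp
  obtain ⟨F, hF⟩ := geometric_hahn_banach_open_point huc.convex_strict_epigraph hopen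
    (x := (x, u x)) (by simp)
  have hsplit : ∀ y t, F (y, t) = F (y, 0) + t * F (0, 1) := by
    intro y t
    rw [show ((y, t) : EuclideanSpace ℝ (Fin d) × ℝ) = (y, 0) + t • (0, 1) by simp, map_add,
      map_smul, smul_eq_mul]
  -- The separating hyperplane is not vertical, since `(x, u x + 1)` lies in the strict epigraph
  -- over `x` itself.
  have hq : F (0, 1) < 0 := by
    have := hF (x, u x + 1) ⟨hx, by simp⟩
    rw [hsplit x (u x + 1), hsplit x (u x)] at this
    linarith
  set q := -F (0, 1) with hqdef
  have hq0 : 0 < q := by linarith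
  let L : EuclideanSpace ℝ (Fin d) →L[ℝ] ℝ := F.comp (ContinuousLinearMap.inl ℝ _ ℝ)
  have hL : ∀ y, L y = F (y, 0) := fun y => rfl
  let l : EuclideanSpace ℝ (Fin d) →ᵃ[ℝ] ℝ :=
    q⁻¹ • (L.toLinearMap.toAffineMap - AffineMap.const ℝ _ (L x)) + AffineMap.const ℝ _ (u x)
  have hl : ∀ y, l y = q⁻¹ * (F (y, 0) - F (x, 0)) + u x := fun y => by simp [l, hL]
  have hlu : ∀ y ∈ Ω, l y ≤ f y := by
    intro y hy
    refine le_trans ?_ (hΩ.convexEnvelope_le hf (subset_closure hy))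
    rw [← hu]
    refine le_of_forall_gt_imp_ge_of_dense fun t ht => ?_
    have := hF (y, t) ⟨hy, ht⟩
    rw [hsplit y t, hsplit x (u x)] at this
    rw [hl, ← le_sub_iff_add_le, inv_mul_le_iff₀ hq0]
    have hF01 : F (0, 1) = -q := by simp [hqdef]
    rw [hF01] at this
    nlinarith
  refine ⟨l, fun y hy => ?_, by rw [hl]; simp⟩
  have hcl : closure Ω ⊆ closure Ω ∩ (fun y => f y - l y) ⁻¹' Set.Ici 0 := by
    refine closure_minimal (fun y hy => ⟨subset_closure hy, ?_⟩)
      ((hf.sub l.continuous_of_finiteDimensional.continuousOn).preimage_isClosed_of_isClosed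
        isClosed_closure isClosed_Ici)
    simpa using hlu y hy
  have := (hcl hy).2
  simpa using this

/-- A point where an affine minorant `l` touches the envelope lies in the convex hull of the points
where `l` touches `f`. -/
theorem IsStrictlyConvexDomain.mem_convexHull_contact (hΩ : IsStrictlyConvexDomain Ω)
    (hf : ContinuousOn f (closure Ω)) {x : EuclideanSpace ℝ (Fin d)} (hx : x ∈ closure Ω)
    {l : EuclideanSpace ℝ (Fin d) →ᵃ[ℝ] ℝ} (hl : ∀ y ∈ closure Ω, l y ≤ f y)
    (hlx : l x = convexEnvelope Ω f x) :
    x ∈ convexHull ℝ {y | y ∈ closure Ω ∧ f y = l y} := by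
  by_contra hxC
  have hfl : ContinuousOn (fun y => f y - l y) (closure Ω) :=
    hf.sub l.continuous_of_finiteDimensional.continuousOn
  have hC : IsCompact {y | y ∈ closure Ω ∧ f y = l y} := by
    have := hΩ.isCompact_closure.of_isClosed_subset
      (hfl.preimage_isClosed_of_isClosed isClosed_closure (isClosed_singleton (x := 0)))
      Set.inter_subset_left
    convert this using 1
    ext y
    simp [sub_eq_zero]
  obtain ⟨m, c, hm1, hm2⟩ := geometric_hahn_banach_closed_point (convex_convexHull ℝ _)
    hC.isCompact_convexHull.isClosed hxC
  -- On this cap, which misses the contact set, `f - l` has a positive minimum. Tilting `l` by a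
  -- small multiple of `m - c` keeps it below `f` and raises it at `x`, beyond the supremum.
  have hA : IsCompact (closure Ω ∩ m ⁻¹' Set.Ici c) :=
    hΩ.isCompact_closure.inter_right (isClosed_Ici.preimage m.continuous)
  have hxA : x ∈ closure Ω ∩ m ⁻¹' Set.Ici c := ⟨hx, hm2.le⟩
  obtain ⟨y, hy, hymin⟩ := hA.exists_isMinOn ⟨x, hxA⟩ (hfl.mono Set.inter_subset_left)
  obtain ⟨w, hw, hwmax⟩ := hA.exists_isMaxOn ⟨x, hxA⟩ (f := m) m.continuous.continuousOn
  have hypos : 0 < f y - l y := by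
    refine lt_of_le_of_ne (sub_nonneg.2 (hl y hy.1)) fun h => ?_
    have := hm1 y (subset_convexHull ℝ _ ⟨hy.1, (sub_eq_zero.1 h.symm)⟩)
    have h2 := hy.2
    simp only [Set.mem_preimage, Set.mem_Ici] at h2
    linarith
  have hwx : m x ≤ m w := hwmax hxA
  have hwc : 0 < m w - c := by linarith
  set ε := (f y - l y) / (m w - c) with hε
  have hε0 : 0 < ε := by positivity
  have hεw : ε * (m w - c) = f y - l y := div_mul_cancel₀ _ hwc.ne'
  have hle := le_convexEnvelope (f := f) hx
    (l := l + ε • (m.toLinearMap.toAffineMap - AffineMap.const ℝ _ c)) (fun z hz => by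
      simp only [AffineMap.coe_add, AffineMap.coe_smul, AffineMap.coe_sub, Pi.add_apply,
        Pi.smul_apply, Pi.sub_apply, LinearMap.coe_toAffineMap, AffineMap.const_apply,
        smul_eq_mul, ContinuousLinearMap.coe_coe]
      by_cases hzm : c ≤ m z
      · have h1 : f y - l y ≤ f z - l z := hymin ⟨hz, hzm⟩
        have h2 : m z ≤ m w := hwmax ⟨hz, hzm⟩
        have h3 := mul_le_mul_of_nonneg_left (sub_le_sub_right h2 c) hε0.le
        linarith
      · have := mul_pos hε0 (by linarith : 0 < c - m z)
        linarith [hl z hz])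
  simp only [AffineMap.coe_add, AffineMap.coe_smul, AffineMap.coe_sub, Pi.add_apply,
    Pi.smul_apply, Pi.sub_apply, LinearMap.coe_toAffineMap, AffineMap.const_apply,
    smul_eq_mul, ContinuousLinearMap.coe_coe] at hle
  have := mul_pos hε0 (by linarith : 0 < m x - c)
  linarith

end Envelope

/-! ### The upper bound -/

section UpperBound

variable {d : ℕ} {Ω : Set (EuclideanSpace ℝ (Fin d))} {f : EuclideanSpace ℝ (Fin d) → ℝ}

/-- A point of a polytope far from the vertices is the midpoint of a segment in the polytope. -/
theorem exists_segment_mem_convexHull {E : Type*} [NormedAddCommGroup E] [NormedSpace ℝ E]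
    {t : Finset E} {n : ℕ} (ht : t.card ≤ n) {p : E} (hp : p ∈ convexHull ℝ (t : Set E))
    {s δ : ℝ} (hδ : 0 < δ) (hs : δ * n ≤ s) (hfar : ∀ y ∈ t, s < dist p y) :
    ∃ e : E, ‖e‖ = 1 ∧ p + δ • e ∈ convexHull ℝ (t : Set E) ∧
      p - δ • e ∈ convexHull ℝ (t : Set E) := by
  classical
  obtain ⟨c, hc0, hc1, hcp⟩ := Finset.mem_convexHull'.1 hp
  -- Some weight is at least `1 / n`. One can move from `p` towards this vertex and equally far away
  -- from it before its weight becomes negative.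
  obtain ⟨y, hy, hcy⟩ : ∃ y ∈ t, 1 ≤ n * c y := by
    by_contra! h
    have hne : t.Nonempty := by
      rw [← Finset.coe_nonempty, ← convexHull_nonempty_iff (𝕜 := ℝ)]
      exact ⟨p, hp⟩
    have h1 : ∑ y ∈ t, n * c y < ∑ y ∈ t, (1 : ℝ) := Finset.sum_lt_sum_of_nonempty hne h
    rw [← Finset.mul_sum, hc1] at h1
    simp only [mul_one, Finset.sum_const, nsmul_eq_mul] at h1
    exact absurd (Nat.cast_lt.1 h1) (not_lt.2 ht)
  have hR : s < ‖y - p‖ := by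
    rw [← dist_eq_norm, dist_comm]; exact hfar y hy
  have hn : (0 : ℝ) ≤ n := Nat.cast_nonneg n
  have hR0 : 0 < ‖y - p‖ := (mul_nonneg hδ.le hn).trans_lt (hs.trans_lt hR)
  set τ := δ / ‖y - p‖ with hτ
  have hτ0 : 0 ≤ τ := by positivity
  have hτn : τ * n ≤ 1 := by
    rw [hτ, div_mul_eq_mul_div, div_le_one hR0]
    exact hs.trans hR.le
  have hcy1 : c y ≤ 1 := hc1 ▸ Finset.single_le_sum hc0 hy
  have hτc : τ ≤ c y := by
    nlinarith [mul_le_mul_of_nonneg_left hcy hτ0, mul_le_mul_of_nonneg_right hτn (hc0 y hy)]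
  have hsm : δ • (‖y - p‖⁻¹ • (y - p)) = τ • (y - p) := by
    rw [smul_smul, hτ, div_eq_mul_inv]
  refine ⟨‖y - p‖⁻¹ • (y - p), ?_, ?_, ?_⟩
  · rw [norm_smul, norm_inv, norm_norm, inv_mul_cancel₀ hR0.ne']
  · rw [hsm]
    exact (convex_convexHull ℝ _).add_smul_sub_mem hp (subset_convexHull ℝ _ hy)
      ⟨hτ0, hτc.trans hcy1⟩
  · rw [hsm, Finset.mem_convexHull']
    refine ⟨fun z => (1 + τ) * c z - if z = y then τ else 0, fun z hz => ?_, ?_, ?_⟩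
    · dsimp only
      split_ifs with h
      · subst h
        nlinarith [mul_nonneg hτ0 (hc0 z hz)]
      · have := hc0 z hz
        simp only [sub_zero]
        positivity
    · rw [Finset.sum_sub_distrib, ← Finset.mul_sum, hc1, Finset.sum_ite_eq' t y, if_pos hy]
      ring
    · simp only [sub_smul, mul_smul, ite_smul, zero_smul]
      rw [Finset.sum_sub_distrib, ← Finset.smul_sum, hcp, Finset.sum_ite_eq' t y, if_pos hy]
      module

/-- Barrier argument: a discrete subsolution is compared, at its interior nodes, with a quadratic
perturbation of an affine function `l`, built from the distance to a polytope containing the given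
point. -/
theorem IsTwoScaleSubsolution.le_affine_add (hd : 1 ≤ d)
    {K : Geometry.SimplicialComplex ℝ (EuclideanSpace ℝ (Fin d))} {δ θ : ℝ}
    {S : Finset (EuclideanSpace ℝ (Fin d))} (hK : IsInscribedMesh Ω K) (hδ : 0 < δ)
    (hS : IsDirectionSet θ S) {w : EuclideanSpace ℝ (Fin d) → ℝ}
    (hw : IsTwoScaleSubsolution Ω f K δ S w) (l : EuclideanSpace ℝ (Fin d) →ᵃ[ℝ] ℝ)
    {t : Finset (EuclideanSpace ℝ (Fin d))} {n : ℕ} (ht : t.card ≤ n)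
    {x₀ : EuclideanSpace ℝ (Fin d)} (hx₀ : x₀ ∈ K.vertices)
    (hx₀t : x₀ ∈ convexHull ℝ (t : Set (EuclideanSpace ℝ (Fin d))))
    {A B D κ c s : ℝ} (hκ : 0 ≤ κ) (hc : 0 ≤ c) (hs : 0 ≤ s) (hn : δ * n ≤ s)
    (hD : ∀ x ∈ K.vertices, ‖x - x₀‖ ≤ D) (hB : ∀ x ∈ K.vertices, f x ≤ l x + B)
    (hBs : B ≤ κ * s ^ 2) (hcA : c * D ^ 2 ≤ A)
    (hsmall : κ * (δ ^ 2 * θ ^ 2 + meshSize K ^ 2) < c * δ ^ 2)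
    (hnear : ∀ x ∈ K.vertices, ∀ p ∈ convexHull ℝ (t : Set (EuclideanSpace ℝ (Fin d))),
      dist x p ≤ s → (x ∈ boundaryNodes Ω K ∨ (x ∈ interiorNodes Ω K ∧
        Metric.infDist x (frontier (meshDomain K)) < δ) ∨ ∃ y ∈ t, dist p y ≤ s) →
      f x ≤ l x + A - c * D ^ 2) :
    w x₀ ≤ l x₀ + A := by
  set P := convexHull ℝ (t : Set (EuclideanSpace ℝ (Fin d))) with hP
  have hPc : IsCompact P := t.finite_toSet.isCompact_convexHull ℝ
  -- At a node maximizing `w - φ`, either the obstacle gives `w ≤ φ` or the second difference gives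
  -- a contradiction.
  set φ : EuclideanSpace ℝ (Fin d) → ℝ := fun x =>
    l x + A + κ * Metric.infDist x P ^ 2 - c * ‖x - x₀‖ ^ 2 with hφ
  obtain ⟨x, hx, hxmax⟩ := hK.vertices_finite.exists_maximalFor (fun v => w v - φ v) _
    hK.vertices_nonempty
  have hmax : ∀ v ∈ K.vertices, w v - φ v ≤ w x - φ x := by
    intro v hv
    rcases le_total (w v - φ v) (w x - φ x) with h | h
    · exact h
    · exact hxmax hv h
  suffices hle : w x ≤ φ x by
    have h1 := hmax x₀ hx₀
    have h2 : φ x₀ = l x₀ + A := by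
      simp [hφ, Metric.infDist_zero_of_mem hx₀t]
    linarith
  obtain ⟨π, hπ, hxπ⟩ := hPc.exists_infDist_eq_dist ⟨x₀, hx₀t⟩ x
  have hquad : c * ‖x - x₀‖ ^ 2 ≤ c * D ^ 2 :=
    mul_le_mul_of_nonneg_left (pow_le_pow_left₀ (norm_nonneg _) (hD x hx) 2) hc
  have hwf := hw.le_obstacle x hx
  have hφx : φ x = l x + A + κ * dist x π ^ 2 - c * ‖x - x₀‖ ^ 2 := by rw [hφ, ← hxπ]
  have hκd : 0 ≤ κ * dist x π ^ 2 := by positivity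
  rcases lt_or_ge s (dist x π) with hsπ | hsπ
  · have h1 := mul_le_mul_of_nonneg_left (pow_le_pow_left₀ hs hsπ.le 2) hκ
    linarith [hB x hx]
  by_cases hbad : x ∈ boundaryNodes Ω K ∨ (x ∈ interiorNodes Ω K ∧
        Metric.infDist x (frontier (meshDomain K)) < δ) ∨ ∃ y ∈ t, dist π y ≤ s
  · linarith [hnear x hx π hπ hsπ hbad]
  exfalso
  push Not at hbad
  obtain ⟨hxb, hxd, hfar⟩ := hbad
  have hxi : x ∈ interiorNodes Ω K := ⟨hx, hxb⟩
  have hscale : localScale K δ x = δ := min_eq_left (hxd hxi)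
  obtain ⟨e, he1, hep, hem⟩ := exists_segment_mem_convexHull ht hπ hδ hn hfar
  obtain ⟨v, hvS, hve⟩ := hS.2 e he1
  have hv1 := hS.1 v hvS
  -- Replacing the distance to `P` by that to one point `p ∈ P` leaves an exact quadratic, whose
  -- interpolation error is at most `h²`. The error of `-c |· - x₀|²` has the favourable sign.
  have hbound : ∀ q ∈ K.space, ∀ p ∈ P, w q ≤ (w x - φ x) +
      (l q + A + κ * (‖q - p‖ ^ 2 + meshSize K ^ 2) - c * ‖q - x₀‖ ^ 2) := by
    intro q hq p hp
    obtain ⟨s', a, hs', ha0, ha1, haq, hpl⟩ := hK.exists_weights hq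
    have hsp := sum_mul_sq_norm_sub ha1 p
    have hsx := sum_mul_sq_norm_sub ha1 x₀
    rw [haq] at hsp hsx
    have hl := l.map_sum_smul ha1
    rw [haq] at hl
    have hvar0 : 0 ≤ ∑ z ∈ s', a z * ‖z - q‖ ^ 2 :=
      Finset.sum_nonneg fun z hz => mul_nonneg (ha0 z hz) (sq_nonneg _)
    have hvar1 : ∑ z ∈ s', a z * ‖z - q‖ ^ 2 ≤ meshSize K ^ 2 := by
      calc ∑ z ∈ s', a z * ‖z - q‖ ^ 2 ≤ ∑ z ∈ s', a z * meshSize K ^ 2 := by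
            refine Finset.sum_le_sum fun z hz => mul_le_mul_of_nonneg_left ?_ (ha0 z hz)
            refine pow_le_pow_left₀ (norm_nonneg _) ?_ 2
            rw [← dist_eq_norm, dist_comm]
            exact (hs' z hz).2
        _ = meshSize K ^ 2 := by rw [← Finset.sum_mul, ha1, one_mul]
    have hterm : ∀ z ∈ s', a z * w z ≤ a z * (w x - φ x + A) + a z * l z +
        κ * (a z * ‖z - p‖ ^ 2) - c * (a z * ‖z - x₀‖ ^ 2) := by
      intro z hz
      have h1 := hmax z (hs' z hz).1
      have h2 : Metric.infDist z P ^ 2 ≤ ‖z - p‖ ^ 2 := by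
        refine pow_le_pow_left₀ Metric.infDist_nonneg ?_ 2
        rw [← dist_eq_norm]
        exact Metric.infDist_le_dist_of_mem hp
      have h3 := mul_le_mul_of_nonneg_left h2 hκ
      have h4 : w z ≤ (w x - φ x + A) + l z + κ * ‖z - p‖ ^ 2 - c * ‖z - x₀‖ ^ 2 := by
        simp only [hφ] at h1 ⊢
        linarith
      have := mul_le_mul_of_nonneg_left h4 (ha0 z hz)
      linarith
    rw [hpl w hw.piecewiseLinear]
    refine (Finset.sum_le_sum hterm).trans ?_
    rw [Finset.sum_sub_distrib, Finset.sum_add_distrib, Finset.sum_add_distrib, ← Finset.sum_mul,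
      ha1, ← hl, ← Finset.mul_sum, ← Finset.mul_sum, hsp, hsx]
    have h5 := mul_le_mul_of_nonneg_left hvar1 hκ
    have h6 := mul_nonneg hc hvar0
    linarith
  have hmem := hK.add_smul_mem_space hd hδ hxi hv1
  have havg := hw.le_average x hxi v hvS
  -- Pair `x ± δv` with `π ± δe` in `P`. By the parallelogram law the distance term costs `κδ²|v -
  -- e|² ≤ κδ²θ²`, and `hsmall` contradicts the average inequality.
  rw [hscale] at hmem havg
  have hb1 := hbound _ hmem.1 _ hep
  have hb2 := hbound _ hmem.2 _ hem
  have hl2 : l (x + δ • v) + l (x - δ • v) = 2 * l x := by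
    have hl : ∀ z, l z = l.linear z + l 0 := fun z => congrFun l.decomp z
    rw [hl (x + _), hl (x - _), hl x, map_add, map_sub]
    ring
  have hpar1 := parallelogram_law_with_norm ℝ (x - π) (δ • (v - e))
  have hpar2 := parallelogram_law_with_norm ℝ (x - x₀) (δ • v)
  have e1 : x + δ • v - (π + δ • e) = x - π + δ • (v - e) := by module
  have e2 : x - δ • v - (π - δ • e) = x - π - δ • (v - e) := by module
  have e3 : x + δ • v - x₀ = x - x₀ + δ • v := by abel
  have e4 : x - δ • v - x₀ = x - x₀ - δ • v := by abel
  rw [e1, e3] at hb1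
  rw [e2, e4] at hb2
  rw [norm_smul, Real.norm_of_nonneg hδ.le] at hpar1 hpar2
  rw [hv1, mul_one] at hpar2
  have hve2 : ‖v - e‖ ^ 2 ≤ θ ^ 2 := by
    refine pow_le_pow_left₀ (norm_nonneg _) ?_ 2
    rwa [norm_sub_rev]
  have hve3 := mul_le_mul_of_nonneg_left (mul_le_mul_of_nonneg_left hve2 (sq_nonneg δ)) hκ
  have hp1 : κ * ‖x - π + δ • (v - e)‖ ^ 2 + κ * ‖x - π - δ • (v - e)‖ ^ 2 =
      2 * (κ * ‖x - π‖ ^ 2) + 2 * (κ * (δ ^ 2 * ‖v - e‖ ^ 2)) := by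
    linear_combination κ * hpar1
  have hp2 : c * ‖x - x₀ + δ • v‖ ^ 2 + c * ‖x - x₀ - δ • v‖ ^ 2 =
      2 * (c * ‖x - x₀‖ ^ 2) + 2 * (c * δ ^ 2) := by
    linear_combination c * hpar2
  rw [dist_eq_norm] at hφx
  linarith

/-- The slope of an affine minorant at a point where it is not too small. -/
theorem affineMap_sub_le_of_le_on_closedBall {E : Type*} [NormedAddCommGroup E] [NormedSpace ℝ E]
    {l : E →ᵃ[ℝ] ℝ} {x : E} {ρ M : ℝ} (hρ : 0 < ρ) (hx : -M ≤ l x)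
    (hl : ∀ y ∈ Metric.closedBall x ρ, l y ≤ M) (a b : E) :
    l a - l b ≤ 2 * M / ρ * dist a b := by
  have hdec : ∀ z, l z = l.linear z + l 0 := fun z => congrFun l.decomp z
  by_cases hab : a = b
  · simp [hab]
  have hn : 0 < ‖a - b‖ := norm_pos_iff.2 (sub_ne_zero.2 hab)
  -- Move from `x` by `ρ` in the direction `a - b`: there `l` rises by at most `2M`.
  have h1 := hl (x + (ρ / ‖a - b‖) • (a - b)) (by
    rw [Metric.mem_closedBall, dist_eq_norm, add_sub_cancel_left, norm_smul,
      Real.norm_of_nonneg (by positivity), div_mul_cancel₀ _ hn.ne'])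
  rw [hdec, map_add, map_smul, smul_eq_mul, map_sub] at h1
  rw [hdec x] at hx
  rw [hdec a, hdec b, dist_eq_norm, div_mul_eq_mul_div, le_div_iff₀ hρ]
  have h2 : ρ / ‖a - b‖ * (l.linear a - l.linear b) ≤ 2 * M := by linarith
  rw [div_mul_eq_mul_div, div_le_iff₀ hn] at h2
  linarith

theorem IsInscribedMesh.meshSize_nonneg
    {K : Geometry.SimplicialComplex ℝ (EuclideanSpace ℝ (Fin d))} (hK : IsInscribedMesh Ω K) :
    0 ≤ meshSize K := by
  obtain ⟨y, hy⟩ := hK.space_nonempty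
  obtain ⟨s, hs, hys⟩ := hK.exists_element hy
  simpa using hK.dist_le_meshSize hs hys hys

theorem IsInscribedMesh.exists_frontier_dist_lt
    {K : Geometry.SimplicialComplex ℝ (EuclideanSpace ℝ (Fin d))} (hd : 1 ≤ d)
    (hK : IsInscribedMesh Ω K) {δ ρ : ℝ} (hδ : 0 < δ) (hρ : δ + meshSize K < ρ)
    {x : EuclideanSpace ℝ (Fin d)} (hx : x ∈ interiorNodes Ω K)
    (hxδ : Metric.infDist x (frontier (meshDomain K)) < δ) :
    ∃ z ∈ frontier Ω, dist x z < ρ := by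
  have hpos : 0 < Metric.infDist x (frontier (meshDomain K)) :=
    (hK.localScale_pos hd hδ hx).trans_le (min_le_right _ _)
  have hne : (frontier (meshDomain K)).Nonempty := by
    by_contra h
    rw [Set.not_nonempty_iff_eq_empty] at h
    rw [h, Metric.infDist_empty] at hpos
    exact hpos.false
  obtain ⟨y, hy, hxy⟩ := (Metric.infDist_lt_iff hne).1 hxδ
  obtain ⟨z, hz, hyz⟩ := hK.exists_frontier_dist_le hy
    (ε := ρ - (δ + meshSize K)) (by linarith)
  exact ⟨z, hz, by linarith [dist_triangle x y z]⟩

theorem IsStrictlyConvexDomain.closedBall_subset_closure (hΩ : IsStrictlyConvexDomain Ω)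
    {x : EuclideanSpace ℝ (Fin d)} (hx : x ∈ closure Ω) {ρ : ℝ} (hρ : 0 < ρ)
    (h : ∀ z ∈ frontier Ω, ρ ≤ dist x z) : x ∈ Ω ∧ Metric.closedBall x ρ ⊆ closure Ω := by
  have hxΩ : x ∈ Ω := by
    by_contra hxn
    have := h x (by rw [hΩ.isOpen.frontier_eq]; exact ⟨hx, hxn⟩)
    rw [dist_self] at this
    linarith
  refine ⟨hxΩ, ?_⟩
  by_cases huniv : Ω = Set.univ
  · simp [huniv]
  · obtain ⟨y, hy, hxy⟩ := exists_mem_frontier_infDist_compl_eq_dist hxΩ huniv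
    exact (Metric.closedBall_subset_closedBall (hxy ▸ h y hy)).trans
      (Metric.closedBall_infDist_compl_subset_closure hxΩ)

theorem IsStrictlyConvexDomain.exists_unifCont (hΩ : IsStrictlyConvexDomain Ω)
    {g : EuclideanSpace ℝ (Fin d) → ℝ} (hg : ContinuousOn g (closure Ω)) {η : ℝ} (hη : 0 < η) :
    ∃ ρ : ℝ, 0 < ρ ∧ ∀ x ∈ closure Ω, ∀ y ∈ closure Ω, dist x y < ρ → g x ≤ g y + η := by
  obtain ⟨ρ, hρ, h⟩ := Metric.uniformContinuousOn_iff.1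
    (hΩ.isCompact_closure.uniformContinuousOn_of_continuous hg) η hη
  refine ⟨ρ, hρ, fun x hx y hy hxy => ?_⟩
  have := h x hx y hy hxy
  rw [Real.dist_eq] at this
  linarith [(abs_lt.1 this).2]

/-- Discrete subsolutions are asymptotically below the envelope at the nodes. -/
theorem IsStrictlyConvexDomain.exists_subsolution_le (hd : 1 ≤ d) (hΩ : IsStrictlyConvexDomain Ω)
    (hf : ContinuousOn f (closure Ω)) {η : ℝ} (hη : 0 < η) :
    ∃ r : ℝ, 0 < r ∧ ∀ (K : Geometry.SimplicialComplex ℝ (EuclideanSpace ℝ (Fin d))) (δ θ : ℝ)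
      (S : Finset (EuclideanSpace ℝ (Fin d))), IsInscribedMesh Ω K → 0 < δ →
      IsDirectionSet θ S → meshSize K < r → δ < r → θ < r → meshSize K / δ < r →
      ∀ w, IsTwoScaleSubsolution Ω f K δ S w → ∀ x ∈ K.vertices,
        w x ≤ convexEnvelope Ω f x + 3 * η := by
  set u := convexEnvelope Ω f with hu
  obtain ⟨M, hM0, hM⟩ := hΩ.exists_bound hf
  obtain ⟨ρ₁, hρ₁, hfρ⟩ := hΩ.exists_unifCont hf (half_pos hη)
  obtain ⟨ρ₂, hρ₂, huρ⟩ := hΩ.exists_unifCont (hΩ.continuousOn_convexEnvelope hf) (half_pos hη)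
  rw [← hu] at huρ
  set ρ := min ρ₁ ρ₂ with hρdef
  have hρ : 0 < ρ := lt_min hρ₁ hρ₂
  have hρle₁ : ρ ≤ ρ₁ := min_le_left _ _
  have hρle₂ : ρ ≤ ρ₂ := min_le_right _ _
  have hfu : ∀ x ∈ closure Ω, (∃ z ∈ frontier Ω, dist x z < ρ) → f x ≤ u x + η := by
    rintro x hx ⟨z, hz, hxz⟩
    have hzc := frontier_subset_closure hz
    have h1 := hfρ x hx z hzc (hxz.trans_le hρle₁)
    have h2 := huρ z hzc x hx (by rw [dist_comm]; exact hxz.trans_le hρle₂)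
    have h3 : u z = f z := hΩ.convexEnvelope_eq_of_mem_frontier hf hz
    linarith
  set Λ := 2 * M / ρ with hΛ
  have hΛ0 : 0 ≤ Λ := by positivity
  -- Within distance `2s` the supporting function varies by at most `η / 2`. The added 1 here and in
  -- `c` and `r` avoids zero denominators.
  set s := min (ρ / 4) (η / (4 * (Λ + 1))) with hsdef
  have hs : 0 < s := by positivity
  have hsρ : s ≤ ρ / 4 := min_le_left _ _
  have hsΛ : Λ * (2 * s) ≤ η / 2 := by
    have h1 : s ≤ η / (4 * (Λ + 1)) := min_le_right _ _
    rw [le_div_iff₀ (by positivity)] at h1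
    nlinarith
  set D := Metric.diam (closure Ω) with hD
  have hD0 : 0 ≤ D := Metric.diam_nonneg
  set B := 2 * M + Λ * D with hB
  have hB0 : 0 ≤ B := by positivity
  set κ := B / s ^ 2 with hκ
  have hκ0 : 0 ≤ κ := by positivity
  set c := η / (D ^ 2 + 1) with hc
  have hc0 : 0 < c := by positivity
  have hcD : c * D ^ 2 ≤ η := by
    rw [hc, div_mul_eq_mul_div, div_le_iff₀ (by positivity)]
    nlinarith
  -- In turn: `δ + h < ρ`; `r² ≤ r`; `δ(d + 1) ≤ s` for the segment in `P`; and `2κr² < c` for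
  -- `hsmall`.
  refine ⟨min (min (ρ / 4) 1) (min (s / (d + 1)) (c / (2 * κ + 1))), by positivity, ?_⟩
  intro K δ θ S hK hδ hS hhr hδr hθr hhδr w hw x₀ hx₀
  set r := min (min (ρ / 4) 1) (min (s / (d + 1)) (c / (2 * κ + 1))) with hr
  have hr0 : 0 < r := by positivity
  have hr1 : r ≤ ρ / 4 := (min_le_left _ _).trans (min_le_left _ _)
  have hr2 : r ≤ 1 := (min_le_left _ _).trans (min_le_right _ _)
  have hr3 : r ≤ s / (d + 1) := (min_le_right _ _).trans (min_le_left _ _)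
  have hr4 : r ≤ c / (2 * κ + 1) := (min_le_right _ _).trans (min_le_right _ _)
  have hvc : ∀ x ∈ K.vertices, x ∈ closure Ω := fun x hx =>
    hK.space_subset_closure hΩ (Geometry.SimplicialComplex.vertices_subset_space hx)
  have hh0 := hK.meshSize_nonneg
  by_cases hclose : ∃ z ∈ frontier Ω, dist x₀ z < ρ
  · linarith [hw.le_obstacle x₀ hx₀, hfu x₀ (hvc x₀ hx₀) hclose]
  push Not at hclose
  obtain ⟨hx₀Ω, hball⟩ := hΩ.closedBall_subset_closure (hvc x₀ hx₀) hρ hclose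
  obtain ⟨l, hlf, hlx₀⟩ := hΩ.exists_support hf hx₀Ω
  have hux₀ : -M ≤ l x₀ := by
    rw [hlx₀]
    exact le_convexEnvelope (hvc x₀ hx₀) (l := AffineMap.const ℝ _ (-M))
      fun y hy => (abs_le.1 (hM y hy)).1
  have hslope : ∀ a b, l a - l b ≤ Λ * dist a b :=
    affineMap_sub_le_of_le_on_closedBall hρ hux₀ fun y hy =>
      (hlf y (hball hy)).trans (abs_le.1 (hM y (hball hy))).2
  have hxc := hΩ.mem_convexHull_contact hf (hvc x₀ hx₀) hlf hlx₀
  rw [convexHull_eq_union] at hxc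
  simp only [Set.mem_iUnion, exists_prop] at hxc
  obtain ⟨t, htsub, htind, hx₀t⟩ := hxc
  have htcard : t.card ≤ d + 1 := by
    have := htind.card_le_finrank_succ.trans (Nat.succ_le_succ (Submodule.finrank_le _))
    simpa using this
  -- At the vertices of `P` the envelope is at most `f = l`, so by convexity it is at most `l` on
  -- all of `P`.
  have hul : ∀ p ∈ convexHull ℝ (t : Set (EuclideanSpace ℝ (Fin d))),
      p ∈ closure Ω ∧ u p ≤ l p := by
    refine convexHull_min (t := {p | p ∈ closure Ω ∧ u p ≤ l p}) (fun y hy => ?_) ?_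
    · exact ⟨(htsub hy).1, (hΩ.convexEnvelope_le hf (htsub hy).1).trans (htsub hy).2.le⟩
    · intro p hp q hq a b ha hb hab
      refine ⟨hΩ.convex.closure hp.1 hq.1 ha hb hab, ?_⟩
      refine ((hΩ.convexOn_convexEnvelope hf).2 hp.1 hq.1 ha hb hab).trans ?_
      rw [Convex.combo_affine_apply hab]
      exact add_le_add (mul_le_mul_of_nonneg_left hp.2 ha) (mul_le_mul_of_nonneg_left hq.2 hb)
  have hdist : ∀ x ∈ K.vertices, dist x x₀ ≤ D := fun x hx =>
    Metric.dist_le_diam_of_mem hΩ.isCompact_closure.isBounded (hvc x hx) (hvc x₀ hx₀)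
  rw [hu, ← hlx₀]
  refine hw.le_affine_add hd hK hδ hS l htcard hx₀ hx₀t (B := B) (D := D) (κ := κ) (c := c)
    (s := s) hκ0 hc0.le hs.le ?_ (fun x hx => dist_eq_norm x x₀ ▸ hdist x hx) ?_ ?_ ?_ ?_ ?_
  · have h1 := hδr.le.trans hr3
    rw [le_div_iff₀ (by positivity)] at h1
    exact_mod_cast h1
  · intro x hx
    have h1 := (abs_le.1 (hM x (hvc x hx))).2
    have h2 := hslope x₀ x
    have h3 := mul_le_mul_of_nonneg_left (hdist x hx) hΛ0
    rw [dist_comm] at h2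
    linarith
  · rw [hκ, div_mul_cancel₀ _ (by positivity)]
  · linarith
  · have hθ0 : 0 ≤ θ := by
      obtain ⟨v, hv⟩ := hS.nonempty hd
      obtain ⟨v', -, hv'⟩ := hS.2 v (hS.1 v hv)
      exact (norm_nonneg _).trans hv'
    have h1 : meshSize K ≤ r * δ := (div_le_iff₀ hδ).1 hhδr.le
    have h2 : meshSize K ^ 2 ≤ r ^ 2 * δ ^ 2 := by
      rw [← mul_pow]; exact pow_le_pow_left₀ hh0 h1 2
    have h3 : δ ^ 2 * θ ^ 2 ≤ r ^ 2 * δ ^ 2 := by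
      rw [mul_comm]
      exact mul_le_mul_of_nonneg_right (pow_le_pow_left₀ hθ0 hθr.le 2) (sq_nonneg δ)
    have h4 : r * (2 * κ + 1) ≤ c := (le_div_iff₀ (by positivity)).1 hr4
    have h5 : κ * (2 * r ^ 2) < c := by nlinarith
    have h6 := mul_le_mul_of_nonneg_left (add_le_add h3 h2) hκ0
    have h7 := mul_lt_mul_of_pos_right h5 (pow_pos hδ 2)
    linarith
  · intro x hx p hp hxp hcases
    have hxc := hvc x hx
    -- The chain is `f x ≤ u x + η`, `u x ≤ u p + η / 2`, `u p ≤ l p`, `l p ≤ l x + Λs`. The total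
    -- error is at most `2η`, and `c D² ≤ η`.
    have hnearb : (∃ z ∈ frontier Ω, dist x z < ρ) → f x ≤ l x + 3 * η - c * D ^ 2 := by
      intro hz
      have h1 := hfu x hxc hz
      have h2 := huρ x hxc p (hul p hp).1 (by linarith)
      have h3 := (hul p hp).2
      have h4 := hslope p x
      rw [dist_comm] at h4
      have h5 := mul_le_mul_of_nonneg_left hxp hΛ0
      have h6 := mul_nonneg hΛ0 hs.le
      linarith
    rcases hcases with hxb | ⟨hxi, hxd⟩ | ⟨y, hy, hpy⟩
    · exact hnearb ⟨x, hxb.2, by rwa [dist_self]⟩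
    · exact hnearb (hK.exists_frontier_dist_lt hd hδ (by linarith) hxi hxd)
    · have hxy : dist x y ≤ 2 * s := by linarith [dist_triangle x p y]
      have h1 := hfρ x hxc y (htsub hy).1 (by linarith)
      have h2 : f y = l y := (htsub hy).2
      have h3 := hslope y x
      rw [dist_comm] at h3
      have h5 := mul_le_mul_of_nonneg_left hxy hΛ0
      linarith

end UpperBound

/-! ### Well-posedness and convergence -/

theorem theorem2p5 {d : ℕ} (hd : 1 ≤ d) (Ω : Set (EuclideanSpace ℝ (Fin d)))
    (hΩ : IsStrictlyConvexDomain Ω) (f : EuclideanSpace ℝ (Fin d) → ℝ)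
    (hf : ContinuousOn f (closure Ω)) :
    -- the discrete solution exists and is unique (as a function on the closure of `Ω_h`)
    (∀ (K : Geometry.SimplicialComplex ℝ (EuclideanSpace ℝ (Fin d))) (δ θ : ℝ)
        (S : Finset (EuclideanSpace ℝ (Fin d))),
      IsInscribedMesh Ω K → 0 < δ → IsDirectionSet θ S →
        ∃ u : EuclideanSpace ℝ (Fin d) → ℝ, IsTwoScaleSolution Ω f K δ S u ∧
          ∀ w : EuclideanSpace ℝ (Fin d) → ℝ, IsTwoScaleSolution Ω f K δ S w →
            Set.EqOn w u (closure (meshDomain K))) ∧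
    -- and it converges uniformly to the convex envelope as `h, δ, θ, h / δ → 0`
    (∀ σ κ η : ℝ, 0 < η → ∃ r : ℝ, 0 < r ∧
      ∀ (K : Geometry.SimplicialComplex ℝ (EuclideanSpace ℝ (Fin d))) (δ θ : ℝ)
        (S : Finset (EuclideanSpace ℝ (Fin d))),
        IsInscribedMesh Ω K → IsShapeRegular σ K → IsQuasiUniform κ K →
        0 < δ → IsDirectionSet θ S →
        meshSize K < r → δ < r → θ < r → meshSize K / δ < r →
          ∀ u : EuclideanSpace ℝ (Fin d) → ℝ, IsTwoScaleSolution Ω f K δ S u →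
            ∀ x ∈ closure (meshDomain K), |u x - convexEnvelope Ω f x| < η) := by
  refine ⟨fun K δ θ S hK hδ hS => ?_, fun _ _ η hη => ?_⟩
  · obtain ⟨u, hu⟩ := hK.exists_twoScaleSolution hd hδ (hS.nonempty hd) hS.1 f
    refine ⟨u, hu, fun w hw => ?_⟩
    rw [hK.closure_meshDomain]
    exact hw.eqOn hd hK hδ (hS.nonempty hd) hS.1 hu
  · obtain ⟨r₁, hr₁, hupper⟩ :=
      hΩ.exists_subsolution_le hd hf (η := η / 8) (by positivity)
    obtain ⟨r₂, hr₂, hcont⟩ := hΩ.exists_unifCont (hΩ.continuousOn_convexEnvelope hf)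
      (η := η / 8) (by positivity)
    refine ⟨min r₁ r₂, lt_min hr₁ hr₂, ?_⟩
    intro K δ θ S hK _ _ hδ hS hh hδr hθr hhδ u hu x hx
    rw [hK.closure_meshDomain] at hx
    have hle₁ : min r₁ r₂ ≤ r₁ := min_le_left _ _
    have hSne := hS.nonempty hd
    have husub := hu.isSubsolution hd hK hδ hSne
    have hnode := hupper K δ θ S hK hδ hS (hh.trans_le hle₁) (hδr.trans_le hle₁)
      (hθr.trans_le hle₁) (hhδ.trans_le hle₁) u husub
    have hsub := hK.space_subset_closure hΩ
    -- Affine functions have zero second differences, so minorants of `f` are subsolutions, with no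
    -- error term.
    have hlow : convexEnvelope Ω f x ≤ u x := by
      refine hΩ.convexEnvelope_le_of_forall hf fun l hl => ?_
      have hlsub : IsTwoScaleSubsolution Ω f K δ S l :=
        ⟨isPiecewiseLinear_affineMap l, fun y hy =>
          hl y (hsub (Geometry.SimplicialComplex.vertices_subset_space hy)), fun y _ v _ => by
          have hdec : ∀ z, l z = l.linear z + l 0 := fun z => congrFun l.decomp z
          rw [hdec (y + _), hdec (y - _), hdec y, map_add, map_sub]
          linarith⟩
      exact hlsub.le_solution hd hK hδ hSne hS.1 hu hx
    -- The nodal error `3η / 8` and the oscillation `η / 8` of the envelope over an element add up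
    -- to `η / 2`.
    have hup : u x ≤ convexEnvelope Ω f x + η / 2 := by
      obtain ⟨s, c, hs, hc0, hc1, -, hpl⟩ := hK.exists_weights hx
      rw [hpl u hu.piecewiseLinear]
      calc ∑ v ∈ s, c v * u v ≤ ∑ v ∈ s, c v * (convexEnvelope Ω f x + η / 2) := by
            refine Finset.sum_le_sum fun v hv => mul_le_mul_of_nonneg_left ?_ (hc0 v hv)
            have h1 := hnode v (hs v hv).1
            have h2 := hcont v
              (hsub (Geometry.SimplicialComplex.vertices_subset_space (hs v hv).1)) x (hsub hx)
              (by
                rw [dist_comm]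
                exact (hs v hv).2.trans_lt (hh.trans_le (min_le_right _ _)))
            linarith
        _ = convexEnvelope Ω f x + η / 2 := by rw [← Finset.sum_mul, hc1, one_mul]
    rw [abs_lt]
    constructor <;> linarith
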